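/- Let $\mathbb K$ be a field of characteristic $0$, $A$ an associative (not necessarily unital) $\mathbb K$-algebra with multiplication $\mu$, and $M$ an $A$-bimodule with left action $l(a,u)=a\cdot u$ and right action $r(u,a)=u\cdot a$, i.e. $(ab)\cdot u=a\cdot(b\cdot u)$, $(a\cdot u)\cdot b=a\cdot(u\cdot b)$, $(u\cdot a)\cdot b=u\cdot(ab)$. Let $H:A\otimes A\to M$ be a Hochschild $2$-cocycle, i.e. a bilinear map with $a\cdot H(b,c)-H(ab,c)+H(a,bc)-H(a,b)\cdot c=0$ for all $a,b,c\in A$. A linear map $T:M\to A$ is an *$H$-twisted Rota–Baxter operator* if $T(u)T(v)=T\big(u\cdot T(v)+T(u)\cdot v+H(Tu,Tv)\big)$ for all $u,v\in M$. Let $L=\bigoplus_{n\ge 0}\mathrm{Hom}(M^{\otimes n},A)$, with $\mathrm{Hom}(M^{\otimes n},A)$ in degree $n$. For $f\in \mathrm{Hom}(V^{\otimes m},W)$ and $g\in\mathrm{Hom}(V^{\otimes n},V)$ put $$(f\circ g)(u_1,\dots,u_{m+n-1})=\sum_{i=1}^m(-1)^{(i-1)(n-1)}f(u_1,\dots,u_{i-1},g(u_i,\dots,u_{i+n-1}),u_{i+n},\dots,u_{m+n-1}),$$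 and for $W=V$ let $[f,g]_{\mathsf G}=f\circ g-(-1)^{(m-1)(n-1)}g\circ f$ be the Gerstenhaber bracket. Regard $L$ as a subspace of $\bigoplus_n\mathrm{Hom}((A\oplus M)^{\otimes n},A\oplus M)$, where $P\in \mathrm{Hom}(M^{\otimes n},A)$ is the map $((a_1,u_1),\dots,(a_n,u_n))\mapsto (P(u_1,\dots,u_n),0)$, and let $\mu+l+r$ be the map $((a,u),(b,v))\mapsto(ab,\,a\cdot v+u\cdot b)$. For $P,Q,R$ of degrees $p,q,r$ put $$[\![P,Q]\!]=(-1)^p[[\mu+l+r,P]_{\mathsf G},Q]_{\mathsf G},$$ $$D(P;Q,R)=-(-1)^{p+qr}\,P\circ H(Q,R),\qquad H(Q,R)(u_1,\dots,u_{q+r})=H\big(Q(u_1,\dots,u_q),R(u_{q+1},\dots,u_{q+r})\big),$$ $$[\![P,Q,R]\!]=D(P;Q,R)-(-1)^{qr}D(P;R,Q)-(-1)^{pq}D(Q;P,R)+(-1)^{p(q+r)}D(Q;R,P)-(-1)^{pq+qr+rp}D(R;Q,P)+(-1)^{(p+q)r}D(R;P,Q).$$ An *$L_\infty$-algebra* is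 a graded vector space $L=\bigoplus_{i\in\mathbb Z} L_i$ with multilinear maps $l_k:L^{\otimes k}\to L$ of degree $2-k$ ($k\ge1$) such that, for homogeneous elements, $l_k(x_{\sigma(1)},\dots,x_{\sigma(k)})=(-1)^\sigma\epsilon(\sigma)\,l_k(x_1,\dots,x_k)$ for all $\sigma\in S_k$, where $\epsilon(\sigma)$ is the Koszul sign, and, for every $n\ge1$, $$\sum_{i+j=n+1}\ \sum_{\sigma}(-1)^\sigma\epsilon(\sigma)(-1)^{i(j-1)}\,l_j\big(l_i(x_{\sigma(1)},\dots,x_{\sigma(i)}),x_{\sigma(i+1)},\dots,x_{\sigma(n)}\big)=0,$$ where $i,j\ge 1$ and $\sigma$ runs over the $(i,n-i)$-unshuffles. A *Maurer–Cartan element* is an $\alpha\in L_1$ such that only finitely many $l_k(\alpha,\dots,\alpha)$ are nonzero and $\sum_{k\ge1}(-1)^{(k-1)(k-2)/2}\frac1{k!}l_k(\alpha,\dots,\alpha)=l_1(\alpha)+\frac1{2!}l_2(\alpha,\alpha)-\frac1{3!}l_3(\alpha,\alpha,\alpha)-\cdots=0$. **Theorem.** The bracket $[\![P,Q]\!]$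 of elements of $L$ lies again in $L$, and $L$ with $l_2=[\![\ ,\ ]\!]$, $l_3=[\![\ ,\ ,\ ]\!]$ and $l_k=0$ for $k\ne2,3$ is an $L_\infty$-algebra. A linear map $T:M\to A$ is an $H$-twisted Rota–Baxter operator if and only if $T\in\mathrm{Hom}(M,A)=L_1$ is a Maurer–Cartan element of this $L_\infty$-algebra. -/

import Mathlib

open scoped DirectSum

noncomputable section

namespace TwistedRB

/-! ### L-infinity algebras and Maurer–Cartan elements -/

section LInfinity

variable {K L : Type*} [Field K] [AddCommGroup L] [Module K L]

/-- The Koszul sign `ε(σ)` of a permutation `σ` of homogeneous elements of degrees `d 0, …, d (n-1)`: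
the product of `(-1) ^ (d (σ a) * d (σ b))` over all inversions `a < b`, `σ b < σ a`. -/
def koszulSign {n : ℕ} (d : Fin n → ℤ) (σ : Equiv.Perm (Fin n)) : ℤˣ :=
  ∏ p : Fin n × Fin n,
    if p.1 < p.2 ∧ σ p.2 < σ p.1 then (d (σ p.1) * d (σ p.2)).negOnePow else 1

/-- `σ` is an `(i, n - i)`-unshuffle:
`σ(1) < ⋯ < σ(i)` and `σ(i+1) < ⋯ < σ(n)`. -/
def IsUnshuffle {n : ℕ} (i : ℕ) (σ : Equiv.Perm (Fin n)) : Prop :=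
  ∀ a b : Fin n, a < b → (b.val < i ∨ i ≤ a.val) → σ a < σ b

open Classical in
/-- The left-hand side of the `n`-th higher Jacobi identity, for elements `x 0, …, x (n-1)` of
degrees `d 0, …, d (n-1)`. The inner bracket has `i + 1` entries, for `i = 0, …, n - 1`, so the
outer one has `n - (i + 1) + 1` entries. -/
def higherJacobi (l : (k : ℕ) → MultilinearMap K (fun _ : Fin k => L) L) (n : ℕ)
    (d : Fin n → ℤ) (x : Fin n → L) : L :=
  ∑ i : Fin n, ∑ σ : Equiv.Perm (Fin n) with IsUnshuffle (i.val + 1) σ,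
    (Equiv.Perm.sign σ * koszulSign d σ * (-1 : ℤˣ) ^ ((i.val + 1) * (n - (i.val + 1)))) •
      l (n - (i.val + 1) + 1)
        (Fin.cons
          (l (i.val + 1) (fun a => x (σ ⟨a.val, by omega⟩)))
          (fun b => x (σ ⟨i.val + 1 + b.val, by omega⟩)))

/-- `(L, l₁, l₂, …)` is an L-infinity algebra with grading `L = ⨁ 𝒜 i`.
(The value `l 0` is not part of the structure.) -/
structure IsLInfinityAlgebra (𝒜 : ℤ → Submodule K L)
    (l : (k : ℕ) → MultilinearMap K (fun _ : Fin k => L) L) : Prop where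
  /-- `L` is the direct sum of the homogeneous parts `𝒜 i`. -/
  graded : DirectSum.IsInternal 𝒜
  /-- `l k` has degree `2 - k`. -/
  degree : ∀ k : ℕ, 1 ≤ k → ∀ (d : Fin k → ℤ) (x : Fin k → L), (∀ a, x a ∈ 𝒜 (d a)) →
    l k x ∈ 𝒜 ((∑ a, d a) + 2 - k)
  /-- `l k` is graded skew-symmetric. -/
  skew : ∀ k : ℕ, 1 ≤ k → ∀ (d : Fin k → ℤ) (x : Fin k → L), (∀ a, x a ∈ 𝒜 (d a)) →
    ∀ σ : Equiv.Perm (Fin k),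
      l k (fun a => x (σ a)) = (Equiv.Perm.sign σ * koszulSign d σ) • l k x
  /-- The higher Jacobi identities. -/
  jacobi : ∀ n : ℕ, 1 ≤ n → ∀ (d : Fin n → ℤ) (x : Fin n → L), (∀ a, x a ∈ 𝒜 (d a)) →
    higherJacobi l n d x = 0

/-- `α` is a Maurer–Cartan element: `α` has degree `1`, only finitely many `l k (α, …, α)` are
nonzero, and `l₁(α) + l₂(α, α) / 2! - l₃(α, α, α) / 3! - l₄(α, α, α, α) / 4! + ⋯ = 0`, the sign of
the `k`-th term being `(-1) ^ ((k - 1) (k - 2) / 2)`. -/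
def IsMaurerCartan (𝒜 : ℤ → Submodule K L)
    (l : (k : ℕ) → MultilinearMap K (fun _ : Fin k => L) L) (α : L) : Prop :=
  α ∈ 𝒜 1 ∧ ∃ N : ℕ, (∀ k, N < k → l k (fun _ => α) = 0) ∧
    ∑ k ∈ Finset.Icc 1 N,
      ((-1 : K) ^ ((k - 1) * (k - 2) / 2) * ((k.factorial : ℕ) : K)⁻¹) • l k (fun _ => α) = 0

end LInfinity

/-! ### Bimodules, cocycles, twisted Rota–Baxter operators -/

section Basic

variable (K A M : Type*) [Field K] [NonUnitalRing A] [Module K A]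
  [AddCommGroup M] [Module K M]

/-- A bimodule structure on `M` over the (not necessarily unital) associative algebra `A`. -/
structure Bimod where
  /-- The left action `a · u`. -/
  left : A →ₗ[K] M →ₗ[K] M
  /-- The right action `u · a`. -/
  right : M →ₗ[K] A →ₗ[K] M
  mul_left : ∀ a b u, left (a * b) u = left a (left b u)
  left_right : ∀ a u b, right (left a u) b = left a (right u b)
  right_mul : ∀ u a b, right (right u a) b = right u (a * b)

variable {K A M}

/-- `H` is a Hochschild 2-cocycle of `A` with values in `M`. -/
def IsHochschildTwoCocycle (B : Bimod K A M) (H : A →ₗ[K] A →ₗ[K] M) : Prop :=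
  ∀ a b c, B.left a (H b c) - H (a * b) c + H a (b * c) - B.right (H a b) c = 0

/-- `T` is an `H`-twisted Rota–Baxter operator. -/
def IsTwistedRotaBaxter (B : Bimod K A M) (H : A →ₗ[K] A →ₗ[K] M) (T : M →ₗ[K] A) : Prop :=
  ∀ u v, T u * T v = T (B.right u (T v) + B.left (T u) v + H (T u) (T v))

end Basic

/-! ### Multilinear maps: insertions and direct sums -/

section Multilinear

variable {K V W X Y : Type*} [Field K] [AddCommGroup V] [Module K V] [AddCommGroup W] [Module K W]
  [AddCommGroup X] [Module K X] [AddCommGroup Y] [Module K Y]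

variable (K V W) in
/-- The space `Hom(V^{⊗ n}, W)`. -/
abbrev Cochain (n : ℕ) : Type _ := MultilinearMap K (fun _ : Fin n => V) W

variable (K V W) in
/-- The graded space `⨁ₙ Hom(V^{⊗ n}, W)`. -/
abbrev Cochains : Type _ := ⨁ n : ℕ, Cochain K V W n

/-- The element of `⨁ₙ Hom(V^{⊗ n}, W)` given by `f ∈ Hom(V^{⊗ n}, W)`. -/
abbrev hom {n : ℕ} (f : Cochain K V W n) : Cochains K V W :=
  DirectSum.lof K ℕ (Cochain K V W) n f

/-- The `m`-tuple `(u₁, …, u_i, g(u_{i+1}, …, u_{i+n}), u_{i+n+1}, …, u_{m+n-1})`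
(the positions `i` are counted from `0`). -/
def insertArgs {m n : ℕ} (i : Fin m) (g : Cochain K V V n) (u : Fin (m + n - 1) → V) :
    Fin m → V := fun j =>
  if h : j < i then u ⟨j.val, by omega⟩
  else if h' : j = i then g (fun k => u ⟨i.val + k.val, by omega⟩)
  else u ⟨j.val + n - 1, by omega⟩

theorem insertArgs_eq {m n : ℕ} (i : Fin m) (g g' : Cochain K V V n) (u : Fin (m + n - 1) → V) :
    insertArgs i g u
      = Function.update (insertArgs i g' u) i (g (fun k => u ⟨i.val + k.val, by omega⟩)) := by
  funext j
  by_cases h : j = i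
  · subst h; simp [insertArgs]
  · simp [insertArgs, h]

theorem insertArgs_update {m n : ℕ} (i : Fin m) (g : Cochain K V V n) (u : Fin (m + n - 1) → V)
    (k : Fin (m + n - 1)) :
    (∃ j : Fin m, ∀ x,
        insertArgs i g (Function.update u k x) = Function.update (insertArgs i g u) j x) ∨
    (∃ k' : Fin n, ∀ x, insertArgs i g (Function.update u k x) =
        Function.update (insertArgs i g u) i
          (g (Function.update (fun a : Fin n => u ⟨i.val + a.val, by omega⟩) k' x))) := by
  have hk := k.isLt
  have hi := i.isLt
  by_cases h2 : i.val ≤ k.val ∧ k.val < i.val + n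
  · right
    refine ⟨⟨k.val - i.val, by omega⟩, fun x => ?_⟩
    have hg : (fun a : Fin n => Function.update u k x ⟨i.val + a.val, by omega⟩)
        = Function.update (fun a : Fin n => u ⟨i.val + a.val, by omega⟩)
            ⟨k.val - i.val, by omega⟩ x := by
      funext a
      simp only [Function.update_apply, Fin.ext_iff]
      split_ifs <;> first | rfl | omega
    rw [insertArgs_eq i g g, hg]
    funext j
    by_cases hj : j = i
    · subst hj; simp
    · have hj' : j.val ≠ i.val := fun h => hj (Fin.ext h)
      rw [Function.update_of_ne hj, Function.update_of_ne hj]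
      simp only [insertArgs, hj, dite_false]
      split_ifs with h
      · have h' : j.val < i.val := h
        rw [Function.update_of_ne]
        intro h3; have := congrArg Fin.val h3; simp only at this; omega
      · have h' : ¬ j.val < i.val := h
        rw [Function.update_of_ne]
        intro h3; have := congrArg Fin.val h3; simp only at this; omega
  · left
    have hg : ∀ x, (fun a : Fin n => Function.update u k x ⟨i.val + a.val, by omega⟩)
        = fun a : Fin n => u ⟨i.val + a.val, by omega⟩ := by
      intro x
      funext a
      rw [Function.update_of_ne]
      intro h; have := congrArg Fin.val h; simp only at this; omega
    by_cases h1 : k.val < i.val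
    · refine ⟨⟨k.val, by omega⟩, fun x => ?_⟩
      funext j
      have hj : j < i ∨ j = i ∨ i < j := lt_trichotomy j i
      rcases hj with h | h | h
      · simp [insertArgs, h, Function.update_apply, Fin.ext_iff]
      · subst h
        have : j ≠ ⟨k.val, by omega⟩ := by
          intro h3; have := congrArg Fin.val h3; simp only at this; omega
        rw [Function.update_of_ne this]
        simp [insertArgs, hg]
      · have h' : i.val < j.val := h
        have : j ≠ ⟨k.val, by omega⟩ := by
          intro h3; have := congrArg Fin.val h3; simp only at this; omega
        rw [Function.update_of_ne this]
        simp only [insertArgs, not_lt_of_gt h, ne_of_gt h, dite_false]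
        rw [Function.update_of_ne]
        intro h3; have := congrArg Fin.val h3; simp only at this; omega
    · refine ⟨⟨k.val + 1 - n, by omega⟩, fun x => ?_⟩
      funext j
      have hj : j < i ∨ j = i ∨ i < j := lt_trichotomy j i
      rcases hj with h | h | h
      · have h' : j.val < i.val := h
        have : j ≠ ⟨k.val + 1 - n, by omega⟩ := by
          intro h3; have := congrArg Fin.val h3; simp only at this; omega
        rw [Function.update_of_ne this]
        simp only [insertArgs, h, dite_true]
        rw [Function.update_of_ne]
        intro h3; have := congrArg Fin.val h3; simp only at this; omega
      · subst h
        have : j ≠ ⟨k.val + 1 - n, by omega⟩ := by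
          intro h3; have := congrArg Fin.val h3; simp only at this; omega
        rw [Function.update_of_ne this]
        simp [insertArgs, hg]
      · have h' : i.val < j.val := h
        simp only [insertArgs, not_lt_of_gt h, ne_of_gt h, dite_false, Function.update_apply,
          Fin.ext_iff]
        split_ifs <;> first | rfl | omega

/-- The insertion `f ∘_i g ∈ Hom(V^{⊗ (m+n-1)}, W)` of `g ∈ Hom(V^{⊗ n}, V)` in the `i`-th entry of
`f ∈ Hom(V^{⊗ m}, W)`. -/
def insertion {m n : ℕ} (f : Cochain K V W m) (g : Cochain K V V n) (i : Fin m) :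
    Cochain K V W (m + n - 1) :=
  MultilinearMap.mk' (fun u => f (insertArgs i g u))
    (by
      intro u k x y
      rcases insertArgs_update i g u k with ⟨j, h⟩ | ⟨k', h⟩
      · simp only [h, MultilinearMap.map_update_add]
      · simp only [h, MultilinearMap.map_update_add])
    (by
      intro u k c x
      rcases insertArgs_update i g u k with ⟨j, h⟩ | ⟨k', h⟩
      · simp only [h, MultilinearMap.map_update_smul]
      · simp only [h, MultilinearMap.map_update_smul])

/-- The composition `f ∘ g = ∑ᵢ (-1)^{(i-1)(n-1)} f(u₁, …, u_{i-1}, g(u_i, …, u_{i+n-1}), …)` for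
`f ∈ Hom(V^{⊗ m}, W)` and `g ∈ Hom(V^{⊗ n}, V)`, as a bilinear map. (The index `i` below starts at
`0`, and `n + 1` has the parity of `n - 1`.) -/
def circ (m n : ℕ) : Cochain K V W m →ₗ[K] Cochain K V V n →ₗ[K] Cochains K V W :=
  LinearMap.mk₂ K
    (fun f g => ∑ i : Fin m, (-1 : K) ^ (i.val * (n + 1)) • hom (insertion f g i))
    (by
      intro f f' g
      rw [← Finset.sum_add_distrib]
      refine Finset.sum_congr rfl fun i _ => ?_
      rw [← smul_add, ← map_add]
      rfl)
    (by
      intro c f g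
      rw [Finset.smul_sum]
      refine Finset.sum_congr rfl fun i _ => ?_
      rw [smul_comm c, ← map_smul (DirectSum.lof K ℕ (Cochain K V W) (m + n - 1)) c]
      rfl)
    (by
      intro f g g'
      rw [← Finset.sum_add_distrib]
      refine Finset.sum_congr rfl fun i _ => ?_
      rw [← smul_add, ← map_add]
      congr 2
      ext u
      change f (insertArgs i (g + g') u) = f (insertArgs i g u) + f (insertArgs i g' u)
      rw [insertArgs_eq i (g + g') 0, insertArgs_eq i g 0, insertArgs_eq i g' 0,
        add_apply, MultilinearMap.map_update_add])
    (by
      intro c f g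
      rw [Finset.smul_sum]
      refine Finset.sum_congr rfl fun i _ => ?_
      rw [smul_comm c, ← map_smul (DirectSum.lof K ℕ (Cochain K V W) (m + n - 1)) c]
      congr 2
      ext u
      change f (insertArgs i (c • g) u) = c • f (insertArgs i g u)
      rw [insertArgs_eq i (c • g) 0, insertArgs_eq i g 0,
        smul_apply, MultilinearMap.map_update_smul])

/-- Bilinear extension to direct sums of bilinear maps given on homogeneous parts. -/
def extend₂ (f : (p q : ℕ) → Cochain K V W p →ₗ[K] Cochain K V W q →ₗ[K] X) :
    Cochains K V W →ₗ[K] Cochains K V W →ₗ[K] X :=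
  DirectSum.toModule K ℕ _ fun p =>
    (DirectSum.toModule K ℕ _ fun q => (f p q).flip).flip

theorem extend₂_hom (f : (p q : ℕ) → Cochain K V W p →ₗ[K] Cochain K V W q →ₗ[K] X) {p q : ℕ}
    (P : Cochain K V W p) (Q : Cochain K V W q) : extend₂ f (hom P) (hom Q) = f p q P Q := by
  simp [extend₂]

/-- Trilinear extension to direct sums of trilinear maps given on homogeneous parts. -/
def extend₃
    (f : (p q r : ℕ) →
      Cochain K V W p →ₗ[K] Cochain K V W q →ₗ[K] Cochain K V W r →ₗ[K] X) :
    Cochains K V W →ₗ[K] Cochains K V W →ₗ[K] Cochains K V W →ₗ[K] X :=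
  extend₂ fun p q => LinearMap.mk₂ K
    (fun P Q => DirectSum.toModule K ℕ _ fun r => f p q r P Q)
    (by intros; ext; simp) (by intros; ext; simp) (by intros; ext; simp) (by intros; ext; simp)

theorem extend₃_hom
    (f : (p q r : ℕ) →
      Cochain K V W p →ₗ[K] Cochain K V W q →ₗ[K] Cochain K V W r →ₗ[K] X) {p q r : ℕ}
    (P : Cochain K V W p) (Q : Cochain K V W q) (R : Cochain K V W r) :
    extend₃ f (hom P) (hom Q) (hom R) = f p q r P Q R := by
  simp [extend₃, extend₂_hom]

variable (K V) in
/-- The Gerstenhaber bracket `[f, g] = f ∘ g - (-1)^{(m-1)(n-1)} g ∘ f` of `f ∈ Hom(V^{⊗ m}, V)` and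
`g ∈ Hom(V^{⊗ n}, V)`. -/
def gerstenhaberHom (m n : ℕ) :
    Cochain K V V m →ₗ[K] Cochain K V V n →ₗ[K] Cochains K V V :=
  LinearMap.mk₂ K (fun f g => circ m n f g - (-1 : K) ^ ((m + 1) * (n + 1)) • circ n m g f)
    (by
      intro f f' g
      simp only [map_add, LinearMap.add_apply, smul_add]
      abel)
    (by
      intro c f g
      simp only [map_smul, LinearMap.smul_apply, smul_sub, smul_comm c])
    (by
      intro f g g'
      simp only [map_add, LinearMap.add_apply, smul_add]
      abel)
    (by
      intro c f g
      simp only [map_smul, LinearMap.smul_apply, smul_sub, smul_comm c])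

/-- The Gerstenhaber bracket on `⨁ₙ Hom(V^{⊗ n}, V)`. -/
def gerstenhaber : Cochains K V V →ₗ[K] Cochains K V V →ₗ[K] Cochains K V V :=
  extend₂ (gerstenhaberHom K V)

/-- The bilinear map `Θ` as a cochain of degree `2`. -/
def ofBilin (Θ : V →ₗ[K] V →ₗ[K] W) : Cochain K V W 2 :=
  MultilinearMap.mk' (fun u => Θ (u 0) (u 1))
    (by intro u k x y; fin_cases k <;> simp)
    (by intro u k c x; fin_cases k <;> simp)

/-- For bilinear `H`, the map `(Q, R) ↦ H(Q(u₁, …, u_q), R(u_{q+1}, …, u_{q+r}))`. -/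
def cup (H : W →ₗ[K] W →ₗ[K] X) (q r : ℕ) :
    Cochain K V W q →ₗ[K] Cochain K V W r →ₗ[K] Cochain K V X (q + r) :=
  LinearMap.mk₂ K
    (fun Q R =>
      ((TensorProduct.lift H).compMultilinearMap (Q.domCoprod R)).domDomCongr finSumFinEquiv)
    (by intros; ext; simp [MultilinearMap.domCoprod_apply])
    (by intros; ext; simp [MultilinearMap.domCoprod_apply])
    (by intros; ext; simp [MultilinearMap.domCoprod_apply])
    (by intros; ext; simp [MultilinearMap.domCoprod_apply])

theorem cup_apply (H : W →ₗ[K] W →ₗ[K] X) {q r : ℕ} (Q : Cochain K V W q) (R : Cochain K V W r)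
    (u : Fin (q + r) → V) :
    cup H q r Q R u = H (Q fun a => u (Fin.castAdd r a)) (R fun b => u (Fin.natAdd q b)) := by
  simp [cup, MultilinearMap.domCoprod_apply]

/-- A bilinear map as a multilinear map in two entries. -/
def toMultilinear₂ (B : V →ₗ[K] V →ₗ[K] W) : MultilinearMap K (fun _ : Fin 2 => V) W := ofBilin B

/-- A trilinear map as a multilinear map in three entries. -/
def toMultilinear₃ (B : V →ₗ[K] V →ₗ[K] V →ₗ[K] W) : MultilinearMap K (fun _ : Fin 3 => V) W :=
  MultilinearMap.mk' (fun x => B (x 0) (x 1) (x 2))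
    (by intro u k x y; fin_cases k <;> simp)
    (by intro u k c x; fin_cases k <;> simp)

variable (K V W) in
/-- The part of degree `d` of `⨁ₙ Hom(V^{⊗ n}, W)`: it is `Hom(V^{⊗ d}, W)` if `d ≥ 0`, and zero
if `d < 0`. -/
def degreePart (d : ℤ) : Submodule K (Cochains K V W) where
  carrier := {x | ∀ n : ℕ, (n : ℤ) ≠ d → x n = 0}
  add_mem' := by
    intro x y hx hy n hn
    rw [DirectSum.add_apply, hx n hn, hy n hn, add_zero]
  zero_mem' := fun _ _ => rfl
  smul_mem' := by
    intro c x hx n hn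
    rw [DirectSum.smul_apply, hx n hn, smul_zero]

end Multilinear

/-! ### The brackets on `⨁ₙ Hom(M^{⊗ n}, A)` -/

section Brackets

variable {K A M : Type*} [Field K] [NonUnitalRing A] [Module K A]
  [IsScalarTower K A A] [SMulCommClass K A A] [AddCommGroup M] [Module K M]

/-- The bilinear map `μ + l + r` on `A ⊕ M`: `((a, u), (b, v)) ↦ (a b, a · v + u · b)`. -/
def semidirect (B : Bimod K A M) : (A × M) →ₗ[K] (A × M) →ₗ[K] (A × M) :=
  ((LinearMap.mul K A).compl₁₂ (LinearMap.fst K A M) (LinearMap.fst K A M)).compr₂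
      (LinearMap.inl K A M)
    + (B.left.compl₁₂ (LinearMap.fst K A M) (LinearMap.snd K A M)
        + B.right.compl₁₂ (LinearMap.snd K A M) (LinearMap.fst K A M)).compr₂
      (LinearMap.inr K A M)

theorem semidirect_apply (B : Bimod K A M) (x y : A × M) :
    semidirect B x y = (x.1 * y.1, B.left x.1 y.2 + B.right x.2 y.1) := by
  simp [semidirect]

variable (K A M) in
/-- The inclusion of `⨁ₙ Hom(M^{⊗ n}, A)` in `⨁ₙ Hom((A ⊕ M)^{⊗ n}, A ⊕ M)`: a map `P` becomes
`((a₁, u₁), …, (aₙ, uₙ)) ↦ (P(u₁, …, uₙ), 0)`. -/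
def incl : Cochains K M A →ₗ[K] Cochains K (A × M) (A × M) :=
  DirectSum.toModule K ℕ _ fun n =>
    { toFun := fun P => hom
        (((LinearMap.inl K A M).compMultilinearMap P).compLinearMap fun _ => LinearMap.snd K A M)
      map_add' := by
        intro P Q
        rw [← map_add]
        congr 1
        ext u <;> simp
      map_smul' := by
        intro c P
        rw [RingHom.id_apply, ← map_smul]
        congr 1
        ext u <;> simp }

variable (K A M) in
/-- The projection of `⨁ₙ Hom((A ⊕ M)^{⊗ n}, A ⊕ M)` onto `⨁ₙ Hom(M^{⊗ n}, A)`. -/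
def proj : Cochains K (A × M) (A × M) →ₗ[K] Cochains K M A :=
  DirectSum.toModule K ℕ _ fun n =>
    { toFun := fun F => hom
        (((LinearMap.fst K A M).compMultilinearMap F).compLinearMap fun _ => LinearMap.inr K A M)
      map_add' := by
        intro P Q
        rw [← map_add]
        congr 1
      map_smul' := by
        intro c P
        rw [RingHom.id_apply, ← map_smul]
        congr 1 }

/-- `[[μ + l + r, x], y]` for `x`, `y` in `⨁ₙ Hom(M^{⊗ n}, A)`, formed with the Gerstenhaber bracket
of multilinear maps on `A ⊕ M`. -/
def doubleBracket (B : Bimod K A M) :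
    Cochains K M A →ₗ[K] Cochains K M A →ₗ[K] Cochains K (A × M) (A × M) :=
  gerstenhaber.compl₁₂ (gerstenhaber (hom (ofBilin (semidirect B))) ∘ₗ incl K A M) (incl K A M)

/-- The derived bracket `⟦P, Q⟧ = (-1)^p [[μ + l + r, P], Q]` on `⨁ₙ Hom(M^{⊗ n}, A)`. -/
def derivedBracket (B : Bimod K A M) :
    Cochains K M A →ₗ[K] Cochains K M A →ₗ[K] Cochains K M A :=
  extend₂ fun p q => (-1 : K) ^ p •
    ((doubleBracket B).compr₂ (proj K A M)).compl₁₂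
      (DirectSum.lof K ℕ (Cochain K M A) p) (DirectSum.lof K ℕ (Cochain K M A) q)

/-- For `P`, `Q`, `R` of degrees `p`, `q`, `r`, the term
`-(-1)^{p+qr} ∑ᵢ (-1)^{(i-1)(q+r-1)} P(u₁, …, u_{i-1}, H(Q(u_i, …), R(u_{i+q}, …)), …, u_{p+q+r-1})`.
-/
def ternaryTerm (H : A →ₗ[K] A →ₗ[K] M) {p q r : ℕ}
    (P : Cochain K M A p) (Q : Cochain K M A q) (R : Cochain K M A r) : Cochains K M A :=
  -((-1 : K) ^ (p + q * r) • circ p (q + r) P (cup H q r Q R))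

/-- The ternary bracket on homogeneous elements. -/
def ternaryHom (H : A →ₗ[K] A →ₗ[K] M) (p q r : ℕ) :
    Cochain K M A p →ₗ[K] Cochain K M A q →ₗ[K] Cochain K M A r →ₗ[K] Cochains K M A :=
  LinearMap.mk₂ K
    (fun P Q =>
      { toFun := fun R =>
          ternaryTerm H P Q R
          - (-1 : K) ^ (q * r) • ternaryTerm H P R Q
          - (-1 : K) ^ (p * q) • ternaryTerm H Q P R
          + (-1 : K) ^ (p * (q + r)) • ternaryTerm H Q R P
          - (-1 : K) ^ (p * q + q * r + r * p) • ternaryTerm H R Q P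
          + (-1 : K) ^ ((p + q) * r) • ternaryTerm H R P Q
        map_add' := by
          intro R R'
          simp only [ternaryTerm, map_add, LinearMap.add_apply, smul_add, neg_add]
          abel
        map_smul' := by
          intro c R
          simp only [ternaryTerm, map_smul, LinearMap.smul_apply, RingHom.id_apply,
            smul_add, smul_sub, smul_neg]
          simp only [smul_comm c] })
    (by
      intro P P' Q; ext1 R
      simp only [LinearMap.coe_mk, AddHom.coe_mk, ternaryTerm, map_add, LinearMap.add_apply,
        smul_add, neg_add]
      abel)
    (by
      intro c P Q; ext1 R
      simp only [LinearMap.coe_mk, AddHom.coe_mk, ternaryTerm, map_smul, LinearMap.smul_apply,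
        smul_add, smul_sub, smul_neg]
      simp only [smul_comm c])
    (by
      intro P Q Q'; ext1 R
      simp only [LinearMap.coe_mk, AddHom.coe_mk, ternaryTerm, map_add, LinearMap.add_apply,
        smul_add, neg_add]
      abel)
    (by
      intro c P Q; ext1 R
      simp only [LinearMap.coe_mk, AddHom.coe_mk, ternaryTerm, map_smul, LinearMap.smul_apply,
        smul_add, smul_sub, smul_neg]
      simp only [smul_comm c])

/-- The ternary bracket `⟦P, Q, R⟧` on `⨁ₙ Hom(M^{⊗ n}, A)` made from `H`. -/
def ternaryBracket (H : A →ₗ[K] A →ₗ[K] M) :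
    Cochains K M A →ₗ[K] Cochains K M A →ₗ[K] Cochains K M A →ₗ[K] Cochains K M A :=
  extend₃ (ternaryHom H)

/-- The structure maps `l₂ = ⟦-, -⟧`, `l₃ = ⟦-, -, -⟧`, and `l_k = 0` for the other `k`. -/
def brackets (B : Bimod K A M) (H : A →ₗ[K] A →ₗ[K] M) :
    (k : ℕ) → MultilinearMap K (fun _ : Fin k => Cochains K M A) (Cochains K M A)
  | 2 => toMultilinear₂ (derivedBracket B)
  | 3 => toMultilinear₃ (ternaryBracket H)
  | _ => 0

/-- The linear map `T : M → A` as an element of `Hom(M^{⊗ 1}, A)` in `⨁ₙ Hom(M^{⊗ n}, A)`. -/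
def ofLinear (T : M →ₗ[K] A) : Cochains K M A :=
  hom (MultilinearMap.ofSubsingleton K M A (0 : Fin 1) T)

end Brackets

end TwistedRB

end

/-! Everything takes place in the graded Lie algebra `⨁ₙ Hom((A ⊕ M)^{⊗ n}, A ⊕ M)` with the
Gerstenhaber bracket and degree arity minus one; this is the method of higher derived brackets. Let
`Θ = μ + l + r`, and let `η` be `((a, u), (b, v)) ↦ (0, H(a, b))`, both of arity two and hence odd.
Three facts carry the proof.

First, `L` is an abelian subalgebra (`gerstenhaber_incl_incl`), because elements of `L` read
components in `M` and return values in `A`. So right brackets with elements of `L` commute up to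
sign. Second, up to sign the two structure maps are `[[Θ, P], Q]` and `[[[η, P], Q], R]`
(`incl_derivedBracket`, `incl_ternaryBracket`), and both land in `L`. Hence a third bracket of `Θ`,
or a fourth bracket of `η`, with elements of `L` is zero. Third, `[Θ, Θ] = 0` is associativity of
the semidirect product, `[Θ, η] = 0` is the cocycle condition, and `[η, η] = 0` because `η` reads
`A` and returns values in `M`.

Bracketing these equations with 3, 4 and 5 elements of `L` respectively and expanding by the Leibniz
rule, only the splittings 2|1, then 2|2 and 1|3, then 3|2 survive. The surviving terms are the
composites `l₂ l₂`, `l₃ l₂` and `l₂ l₃`, and `l₃ l₃`, summed over unshuffles: these are the higher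
Jacobi identities for `n = 3, 4, 5`. In `[Θ, Θ]` and `[η, η]` each term occurs twice, so 2 must be
inverted. For other `n` every composite is zero.

For `T` of degree 1, `l₂(T, T)` is twice the untwisted Rota–Baxter defect and `l₃(T, T, T)` is `-6
T(H(T, T))`, so the Maurer–Cartan sum is exactly the defect of the twisted identity. -/

noncomputable section

namespace TwistedRB

/-! ### Evaluating cochains on infinite sequences -/

section Sequences

variable {K V W : Type*} [Field K] [AddCommGroup V] [Module K V] [AddCommGroup W] [Module K W]

/-- Evaluation of a cochain on the initial segment of a sequence. -/
def evalSeq : Cochains K V W →ₗ[K] (ℕ → V) → W :=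
  DirectSum.toModule K ℕ _ fun n =>
    { toFun := fun f u => f fun a : Fin n => u a
      map_add' := fun _ _ => rfl
      map_smul' := fun _ _ => rfl }

@[simp]
theorem evalSeq_hom {n : ℕ} (f : Cochain K V W n) (u : ℕ → V) :
    evalSeq (hom f) u = f fun a : Fin n => u a := by
  simp [evalSeq]

theorem evalSeq_eq_sum [∀ (n : ℕ) (f : Cochain K V W n), Decidable (f ≠ 0)]
    (x : Cochains K V W) (u : ℕ → V) :
    evalSeq x u = ∑ n ∈ DFinsupp.support x, x n fun a : Fin n => u a := by
  conv_lhs => rw [← DirectSum.sum_support_of x]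
  rw [map_sum, Finset.sum_apply]
  exact Finset.sum_congr rfl fun n _ => evalSeq_hom (x n) u

/-- This is the device that avoids casts between arities such as `m + n - 1 + k - 1` and `m + (n + k
- 1) - 1`: identities in the direct sum are checked on sequences. Components are recovered by
induction on the arity. -/
theorem evalSeq_injective : Function.Injective (evalSeq (K := K) (V := V) (W := W)) := by
  classical
  rw [injective_iff_map_eq_zero]
  intro x hx
  refine DFinsupp.ext fun n => ?_
  induction n using Nat.strong_induction_on with
  | _ n ih =>
    ext v
    -- Padding `v` with zeros gives every component of arity `k > n` a zero entry, at position `k -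
    -- 1`; components of lower arity vanish by induction.
    have h := congrFun hx fun a => if h : a < n then v ⟨a, h⟩ else 0
    rw [evalSeq_eq_sum, Finset.sum_eq_single n] at h
    · simpa using h
    · intro k _ hk
      rcases lt_or_gt_of_ne hk with hk | hk
      · rw [ih k hk]; rfl
      · exact (x k).map_coord_zero ⟨k - 1, by omega⟩ (by simp; omega)
    · intro hn
      rw [DFinsupp.notMem_support_iff.mp hn]; rfl

theorem cochains_ext {x y : Cochains K V W} (h : ∀ u, evalSeq x u = evalSeq y u) : x = y :=
  evalSeq_injective (funext h)

/-- The sequence `u₀, …, u_{i-1}, x, u_{i+n}, u_{i+n+1}, …`. -/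
def insertSeq (i n : ℕ) (x : V) (u : ℕ → V) : ℕ → V := fun j =>
  if j < i then u j else if j = i then x else u (j + n - 1)

theorem evalSeq_insertion {m n : ℕ} (f : Cochain K V W m) (g : Cochain K V V n) (i : Fin m)
    (u : ℕ → V) :
    evalSeq (hom (insertion f g i)) u =
      f fun a : Fin m => insertSeq i n (g fun b : Fin n => u (i + b)) u a := by
  rw [evalSeq_hom]
  change f (insertArgs i g _) = _
  congr 1
  funext j
  simp only [insertArgs, insertSeq, Fin.lt_def, Fin.ext_iff]
  split_ifs <;> rfl

theorem evalSeq_circ {m n : ℕ} (f : Cochain K V W m) (g : Cochain K V V n) (u : ℕ → V) :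
    evalSeq (circ m n f g) u = ∑ i : Fin m, (-1 : K) ^ (i.val * (n + 1)) •
      f fun a : Fin m => insertSeq i n (g fun b : Fin n => u (i + b)) u a := by
  change evalSeq (∑ i : Fin m, (-1 : K) ^ (i.val * (n + 1)) • hom (insertion f g i)) u = _
  simp only [map_sum, map_smul, Finset.sum_apply, Pi.smul_apply, evalSeq_insertion]

end Sequences

/-! ### The graded pre-Lie identity for composition -/

section PreLie

variable {K V : Type*} [Field K] [AddCommGroup V] [Module K V]

/-- The composition `f ∘ g` on `⨁ₙ Hom(V^{⊗ n}, V)`. -/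
def comp : Cochains K V V →ₗ[K] Cochains K V V →ₗ[K] Cochains K V V :=
  extend₂ fun m n => circ m n

@[simp]
theorem comp_hom {m n : ℕ} (f : Cochain K V V m) (g : Cochain K V V n) :
    comp (hom f) (hom g) = circ m n f g :=
  extend₂_hom _ f g

theorem circ_eq_sum {m n : ℕ} (f : Cochain K V V m) (g : Cochain K V V n) :
    circ m n f g = ∑ i : Fin m, (-1 : K) ^ (i.val * (n + 1)) • hom (insertion f g i) := rfl

/-- The sum of the values of `f` with `g` and `h` inserted in two entries, `h` to the left. -/
def parallel {m n k : ℕ} (f : Cochain K V V m) (g : Cochain K V V n) (h : Cochain K V V k)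
    (u : ℕ → V) : V :=
  ∑ i ∈ Finset.range m, ∑ j ∈ Finset.range i, (-1 : K) ^ (i * (n + 1) + j * (k + 1)) •
    f fun a : Fin m => insertSeq i n (g fun b : Fin n => u (i + b + k - 1))
      (insertSeq j k (h fun b : Fin k => u (j + b)) u) a

theorem evalSeq_comp_circ {m n k : ℕ} (f : Cochain K V V m) (g : Cochain K V V n)
    (h : Cochain K V V k) (u : ℕ → V) :
    evalSeq (comp (circ m n f g) (hom h)) u =
      ∑ i ∈ Finset.range m, ∑ j ∈ Finset.range (m + n - 1),
        (-1 : K) ^ (i * (n + 1) + j * (k + 1)) •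
        f fun a : Fin m => insertSeq i n
          (g fun b : Fin n => insertSeq j k (h fun b : Fin k => u (j + b)) u (i + b))
          (insertSeq j k (h fun b : Fin k => u (j + b)) u) a := by
  rw [circ_eq_sum, map_sum, LinearMap.sum_apply, map_sum, Finset.sum_apply, Finset.sum_range]
  refine Finset.sum_congr rfl fun i _ => ?_
  rw [map_smul, LinearMap.smul_apply, comp_hom, map_smul, Pi.smul_apply, evalSeq_circ,
    Finset.smul_sum, Finset.sum_range]
  refine Finset.sum_congr rfl fun j _ => ?_
  rw [smul_smul, ← pow_add, ← evalSeq_hom, evalSeq_insertion]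

theorem evalSeq_comp_hom_circ {m n k : ℕ} (f : Cochain K V V m) (g : Cochain K V V n)
    (h : Cochain K V V k) (u : ℕ → V) :
    evalSeq (comp (hom f) (circ n k g h)) u =
      ∑ i ∈ Finset.range m, ∑ l ∈ Finset.range n,
        (-1 : K) ^ (i * (n + k) + l * (k + 1)) •
        f fun a : Fin m => insertSeq i (n + k - 1)
          (g fun b : Fin n => insertSeq l k (h fun b : Fin k => u (i + (l + b)))
            (fun a => u (i + a)) b) u a := by
  rw [circ_eq_sum, map_sum, map_sum, Finset.sum_apply]
  rw [Finset.sum_comm, Finset.sum_range]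
  refine Finset.sum_congr rfl fun l _ => ?_
  rw [map_smul, comp_hom, map_smul, Pi.smul_apply, evalSeq_circ,
    Finset.smul_sum, Finset.sum_range]
  refine Finset.sum_congr rfl fun j _ => ?_
  have hl : n + k - 1 + 1 = n + k := by have := l.isLt; omega
  rw [smul_smul, ← pow_add, hl, add_comm (l.val * _)]
  congr 3
  funext a
  congr 1
  rw [← evalSeq_hom (u := fun a => u (j + a)), evalSeq_insertion]

/-- Position `j` in `f ∘_i g` lies left of `g`, inside `g`, or right of `g`. In the last block `b`
is the corresponding slot of `f`, so that `j = b + n - 1`. -/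
theorem sum_range_split {X : Type*} [AddCommMonoid X] (F : ℕ → X) {i m : ℕ} (n : ℕ) (hi : i < m) :
    ∑ j ∈ Finset.range (m + n - 1), F j =
      ∑ j ∈ Finset.range i, F j + ∑ l ∈ Finset.range n, F (i + l)
        + ∑ b ∈ Finset.Ioo i m, F (b + n - 1) := by
  have h : m + n - 1 = i + n + (m - 1 - i) := by omega
  rw [h, Finset.sum_range_add, Finset.sum_range_add]
  congr 1
  refine Finset.sum_bij' (fun a _ => a + i + 1) (fun b _ => b - i - 1) ?_ ?_ ?_ ?_ ?_
  · intro a ha; simp at ha ⊢; omega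
  · intro a ha; simp at ha ⊢; omega
  · intro a ha; omega
  · intro a ha; simp at ha ⊢; omega
  · intro a ha; congr 1; omega

/-- In `(f ∘ g) ∘ h` the terms with `h` inside `g` make up `f ∘ (g ∘ h)`. What remains are the terms
with `g` and `h` in different slots of `f`, with `h` on the left or on the right. -/
theorem evalSeq_associator {m n k : ℕ} (f : Cochain K V V m) (g : Cochain K V V n)
    (h : Cochain K V V k) (u : ℕ → V) :
    evalSeq (comp (circ m n f g) (hom h)) u - evalSeq (comp (hom f) (circ n k g h)) u =
      parallel f g h u + (-1 : K) ^ ((n + 1) * (k + 1)) • parallel f h g u := by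
  have key : ∀ i ∈ Finset.range m, ∑ j ∈ Finset.range (m + n - 1),
        (-1 : K) ^ (i * (n + 1) + j * (k + 1)) •
        (f fun a : Fin m => insertSeq i n
          (g fun b : Fin n => insertSeq j k (h fun b : Fin k => u (j + b)) u (i + b))
          (insertSeq j k (h fun b : Fin k => u (j + b)) u) a) =
      ∑ j ∈ Finset.range i, (-1 : K) ^ (i * (n + 1) + j * (k + 1)) •
        (f fun a : Fin m => insertSeq i n (g fun b : Fin n => u (i + b + k - 1))
          (insertSeq j k (h fun b : Fin k => u (j + b)) u) a) +
      ∑ l ∈ Finset.range n, (-1 : K) ^ (i * (n + k) + l * (k + 1)) •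
        (f fun a : Fin m => insertSeq i (n + k - 1)
          (g fun b : Fin n => insertSeq l k (h fun b : Fin k => u (i + (l + b)))
            (fun a => u (i + a)) b) u a) +
      ∑ b ∈ Finset.Ioo i m, (-1 : K) ^ ((n + 1) * (k + 1)) •
        (-1 : K) ^ (b * (k + 1) + i * (n + 1)) •
        (f fun a : Fin m => insertSeq b k (h fun c : Fin k => u (b + c + n - 1))
          (insertSeq i n (g fun c : Fin n => u (i + c)) u) a) := by
    intro i hi
    rw [sum_range_split _ n (Finset.mem_range.mp hi)]
    congr 1
    · congr 1
      · refine Finset.sum_congr rfl fun j hj => ?_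
        have hj := Finset.mem_range.mp hj
        congr 2
        funext a
        congr 2
        funext b
        rw [insertSeq, if_neg (by omega), if_neg (by omega)]
      · refine Finset.sum_congr rfl fun l hl => ?_
        have hl := Finset.mem_range.mp hl
        have hs : (-1 : K) ^ (i * (n + 1) + (i + l) * (k + 1))
            = (-1 : K) ^ (i * (n + k) + l * (k + 1)) := by
          -- The two exponents differ by the even number `2 * i`.
          rw [show i * (n + 1) + (i + l) * (k + 1) = i * (n + k) + l * (k + 1) + 2 * i by ring,
            pow_add _ _ (2 * i), pow_mul _ 2]
          simp
        rw [hs]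
        congr 2
        funext a
        simp only [insertSeq]
        split_ifs <;> first
          | rfl
          | (exfalso; omega)
          | (congr 1; omega)
          | skip
        congr 1
        funext b
        split_ifs <;> first
          | rfl
          | (exfalso; omega)
          | (congr 1; omega)
          | (congr 1; funext c; congr 1; omega)
    · refine Finset.sum_congr rfl fun b hb => ?_
      have hb := Finset.mem_Ioo.mp hb
      have hs : (-1 : K) ^ (i * (n + 1) + (b + n - 1) * (k + 1))
            = (-1 : K) ^ ((n + 1) * (k + 1)) * (-1 : K) ^ (b * (k + 1) + i * (n + 1)) := by
        -- Since `b > i ≥ 0`, writing `b = c + 1` removes the truncated subtraction.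
        obtain ⟨c, rfl⟩ : ∃ c, b = c + 1 := ⟨b - 1, by omega⟩
        rw [← pow_add, show c + 1 + n - 1 = c + n by omega,
          show (n + 1) * (k + 1) + ((c + 1) * (k + 1) + i * (n + 1)) =
            i * (n + 1) + (c + n) * (k + 1) + 2 * (k + 1) by ring,
          pow_add _ _ (2 * (k + 1)), pow_mul _ 2]
        simp
      rw [hs, mul_smul]
      congr 3
      funext a
      simp only [insertSeq]
      split_ifs <;> first
        | rfl
        | (exfalso; omega)
        | (congr 1; omega)
        | (congr 1; funext c; congr 1; omega)
        | (congr 1; funext c; rw [if_pos (by omega)])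
  rw [evalSeq_comp_circ, evalSeq_comp_hom_circ, Finset.sum_congr rfl key,
    Finset.sum_add_distrib, Finset.sum_add_distrib]
  have hswap : ∑ i ∈ Finset.range m, ∑ b ∈ Finset.Ioo i m, (-1 : K) ^ ((n + 1) * (k + 1)) •
        (-1 : K) ^ (b * (k + 1) + i * (n + 1)) •
        (f fun a : Fin m => insertSeq b k (h fun c : Fin k => u (b + c + n - 1))
          (insertSeq i n (g fun c : Fin n => u (i + c)) u) a) =
      (-1 : K) ^ ((n + 1) * (k + 1)) • parallel f h g u := by
    rw [parallel, Finset.smul_sum]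
    simp only [Finset.smul_sum]
    -- Both orders of summation run over the pairs `i < b < m`.
    refine Finset.sum_comm' fun i b => ?_
    simp only [Finset.mem_range, Finset.mem_Ioo]
    omega
  rw [hswap, ← parallel]
  abel

/-- The right-hand side of `evalSeq_associator` is graded symmetric in `g` and `h`. -/
theorem comp_preLie {m n k : ℕ} (f : Cochain K V V m) (g : Cochain K V V n)
    (h : Cochain K V V k) :
    comp (circ m n f g) (hom h) - comp (hom f) (circ n k g h) =
      (-1 : K) ^ ((n + 1) * (k + 1)) •
        (comp (circ m k f h) (hom g) - comp (hom f) (circ k n h g)) := by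
  refine cochains_ext fun u => ?_
  simp only [map_sub, map_smul, Pi.sub_apply, Pi.smul_apply]
  rw [evalSeq_associator, evalSeq_associator, smul_add, smul_smul, mul_comm (k + 1), ← pow_add,
    ← two_mul, pow_mul]
  simp [add_comm]

end PreLie

/-! ### Signs with integral exponents -/

section Sign

variable (K : Type*) [Field K]

/-- The sign `(-1)^n` in `K`. -/
def sg (n : ℤ) : K := ((n.negOnePow : ℤ) : K)

variable {K}

theorem sg_add (a b : ℤ) : sg K (a + b) = sg K a * sg K b := by
  simp [sg, Int.negOnePow_add]

theorem sg_even {a : ℤ} (h : Even a) : sg K a = 1 := by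
  simp [sg, Int.negOnePow_even a h]

theorem sg_odd {a : ℤ} (h : Odd a) : sg K a = -1 := by
  simp [sg, Int.negOnePow_odd a h]

theorem sg_natCast (n : ℕ) : sg K n = (-1) ^ n := by
  rcases Nat.even_or_odd n with h | h
  · rw [sg_even (by exact_mod_cast h), h.neg_one_pow]
  · rw [sg_odd (by exact_mod_cast h), h.neg_one_pow]

theorem sg_eq_or (n : ℤ) : sg K n = 1 ∨ sg K n = -1 := by
  rcases Int.even_or_odd n with h | h
  · exact Or.inl (sg_even h)
  · exact Or.inr (sg_odd h)

theorem sg_congr {a b : ℤ} (h : Even (a - b)) : sg K a = sg K b := by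
  rw [show a = a - b + b by ring, sg_add, sg_even h, one_mul]

theorem sg_mul_pred (m n : ℕ) :
    sg K (((m : ℤ) - 1) * ((n : ℤ) - 1)) = (-1) ^ ((m + 1) * (n + 1)) := by
  rw [← sg_natCast]
  refine sg_congr ⟨-(m + n), ?_⟩
  push_cast
  ring

theorem neg_one_pow_add_mul (m n k : ℕ) : (-1 : K) ^ ((m + n) * (k + 1)) =
    (-1) ^ ((m + 1) * (k + 1)) * (-1) ^ ((n + 1) * (k + 1)) := by
  rw [← pow_add, show (m + 1) * (k + 1) + (n + 1) * (k + 1) = (m + n) * (k + 1) + 2 * (k + 1) by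
    ring, pow_add _ _ (2 * (k + 1)), pow_mul _ 2]
  simp

theorem units_smul_eq {X : Type*} [AddCommGroup X] [Module K X] (e : ℤˣ) (x : X) :
    e • x = ((e : ℤ) : K) • x := by
  rw [Units.smul_def, Int.cast_smul_eq_zsmul]

end Sign

/-! ### Homogeneous elements -/

section Degree

variable {K V W : Type*} [Field K] [AddCommGroup V] [Module K V] [AddCommGroup W] [Module K W]

theorem hom_mem {n : ℕ} (f : Cochain K V W n) : hom f ∈ degreePart K V W n := by
  intro k hk
  exact DirectSum.of_eq_of_ne _ _ _ (by exact_mod_cast hk)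

theorem eq_zero_or_hom_of_mem {d : ℤ} {x : Cochains K V W} (hx : x ∈ degreePart K V W d) :
    x = 0 ∨ ∃ (n : ℕ) (f : Cochain K V W n), d = n ∧ x = hom f := by
  rcases lt_or_ge d 0 with h | h
  · exact Or.inl (DFinsupp.ext fun n => hx n (by omega))
  · lift d to ℕ using h
    refine Or.inr ⟨d, x d, rfl, DFinsupp.ext fun n => ?_⟩
    by_cases hn : n = d
    · subst hn
      exact (DirectSum.of_eq_same _ _).symm
    · rw [hx n (by exact_mod_cast hn)]
      exact (DirectSum.of_eq_of_ne _ _ _ hn).symm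

theorem cochains_induction {p : Cochains K V W → Prop} (x : Cochains K V W) (zero : p 0)
    (hom : ∀ (n : ℕ) (f : Cochain K V W n), p (hom f)) (add : ∀ x y, p x → p y → p (x + y)) :
    p x :=
  DirectSum.induction_on x zero hom add

theorem circ_mem {m n : ℕ} (f : Cochain K V W m) (g : Cochain K V V n) :
    circ m n f g ∈ degreePart K V W (m + n - 1) := by
  refine Submodule.sum_mem (degreePart K V W (m + n - 1)) fun i _ => Submodule.smul_mem _ _ ?_
  -- A summand `i : Fin m` forces `m > 0`, so truncated and integral subtraction agree; for `m = 0`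
  -- the sum is empty.
  have h : ((m : ℤ) + n - 1) = ((m + n - 1 : ℕ) : ℤ) := by have := i.isLt; omega
  rw [h]
  exact hom_mem _

end Degree

/-! ### The graded Lie algebra of the Gerstenhaber bracket -/

section Gerstenhaber

variable {K V : Type*} [Field K] [AddCommGroup V] [Module K V]

theorem gerstenhaber_hom {m n : ℕ} (f : Cochain K V V m) (g : Cochain K V V n) :
    gerstenhaber (hom f) (hom g) =
      circ m n f g - (-1 : K) ^ ((m + 1) * (n + 1)) • circ n m g f :=
  extend₂_hom _ f g

theorem gerstenhaber_circ_left {m n k : ℕ} (f : Cochain K V V m) (g : Cochain K V V n)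
    (h : Cochain K V V k) :
    gerstenhaber (circ m n f g) (hom h) = comp (circ m n f g) (hom h) -
      ((-1 : K) ^ ((m + 1) * (k + 1)) * (-1) ^ ((n + 1) * (k + 1))) •
        comp (hom h) (circ m n f g) := by
  rw [circ_eq_sum]
  simp only [map_sum, LinearMap.sum_apply, Finset.smul_sum, ← Finset.sum_sub_distrib]
  refine Finset.sum_congr rfl fun i _ => ?_
  have hi : m + n - 1 + 1 = m + n := by have := i.isLt; omega
  rw [map_smul, map_smul, map_smul, LinearMap.smul_apply, LinearMap.smul_apply, gerstenhaber_hom,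
    comp_hom, comp_hom, hi, neg_one_pow_add_mul, smul_sub, smul_comm]

theorem gerstenhaber_circ_right {m n k : ℕ} (f : Cochain K V V m) (g : Cochain K V V n)
    (h : Cochain K V V k) :
    gerstenhaber (hom h) (circ m n f g) = comp (hom h) (circ m n f g) -
      ((-1 : K) ^ ((m + 1) * (k + 1)) * (-1) ^ ((n + 1) * (k + 1))) •
        comp (circ m n f g) (hom h) := by
  rw [circ_eq_sum]
  simp only [map_sum, LinearMap.sum_apply, Finset.smul_sum, ← Finset.sum_sub_distrib]
  refine Finset.sum_congr rfl fun i _ => ?_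
  have hi : m + n - 1 + 1 = m + n := by have := i.isLt; omega
  rw [map_smul, map_smul, map_smul, LinearMap.smul_apply, gerstenhaber_hom,
    comp_hom, comp_hom, hi, mul_comm (k + 1), neg_one_pow_add_mul, smul_sub, smul_comm]

/-- A graded pre-Lie product has a graded Lie commutator: after expansion into compositions, the
identity is a signed sum of the pre-Lie identities with `f`, `g` and `h` as outermost map. The signs
depend only on the parities of the three products of shifted degrees. -/
theorem gerstenhaber_jacobi_hom {m n k : ℕ} (f : Cochain K V V m) (g : Cochain K V V n)
    (h : Cochain K V V k) :
    gerstenhaber (gerstenhaber (hom f) (hom g)) (hom h) =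
      gerstenhaber (hom f) (gerstenhaber (hom g) (hom h)) +
      (-1 : K) ^ ((n + 1) * (k + 1)) •
        gerstenhaber (gerstenhaber (hom f) (hom h)) (hom g) := by
  have h1 := comp_preLie f g h
  have h2 := comp_preLie g f h
  have h3 := comp_preLie h f g
  simp only [gerstenhaber_hom, map_sub, map_smul, LinearMap.sub_apply, LinearMap.smul_apply,
    gerstenhaber_circ_left, gerstenhaber_circ_right]
  rw [mul_comm (n + 1) (m + 1), mul_comm (k + 1) (m + 1), mul_comm (k + 1) (n + 1)]
  rcases neg_one_pow_eq_or K ((m + 1) * (n + 1)) with a | a <;>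
  rcases neg_one_pow_eq_or K ((m + 1) * (k + 1)) with b | b <;>
  rcases neg_one_pow_eq_or K ((n + 1) * (k + 1)) with c | c <;>
  rw [c] at h1 <;> rw [b] at h2 <;> rw [a] at h3 <;> rw [a, b, c]
  · linear_combination (norm := module) h1 - h2 + h3
  · linear_combination (norm := module) h1 - h2 - h3
  · linear_combination (norm := module) h1 - h2 - h3
  · linear_combination (norm := module) h1 - h2 + h3
  · linear_combination (norm := module) h1 + h2 + h3
  · linear_combination (norm := module) h1 + h2 - h3
  · linear_combination (norm := module) h1 + h2 - h3
  · linear_combination (norm := module) h1 + h2 + h3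

theorem gerstenhaber_skew {a b : ℤ} {x y : Cochains K V V} (hx : x ∈ degreePart K V V a)
    (hy : y ∈ degreePart K V V b) :
    gerstenhaber x y = -sg K ((a - 1) * (b - 1)) • gerstenhaber y x := by
  rcases eq_zero_or_hom_of_mem hx with rfl | ⟨m, f, rfl, rfl⟩
  · simp
  rcases eq_zero_or_hom_of_mem hy with rfl | ⟨n, g, rfl, rfl⟩
  · simp
  rw [gerstenhaber_hom, gerstenhaber_hom, sg_mul_pred, mul_comm (n + 1)]
  rcases neg_one_pow_eq_or K ((m + 1) * (n + 1)) with h | h <;> rw [h] <;> module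

theorem gerstenhaber_mem {a b : ℤ} {x y : Cochains K V V} (hx : x ∈ degreePart K V V a)
    (hy : y ∈ degreePart K V V b) : gerstenhaber x y ∈ degreePart K V V (a + b - 1) := by
  rcases eq_zero_or_hom_of_mem hx with rfl | ⟨m, f, rfl, rfl⟩
  · simp
  rcases eq_zero_or_hom_of_mem hy with rfl | ⟨n, g, rfl, rfl⟩
  · simp
  rw [gerstenhaber_hom]
  refine Submodule.sub_mem _ (circ_mem f g) (Submodule.smul_mem _ _ ?_)
  rw [add_comm (m : ℤ)]
  exact circ_mem g f

/-- The operator on `⨁ₙ Hom(V^{⊗ n}, V)` multiplying by `(-1)^{(n-1) e}` in arity `n`. -/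
def signOp (e : ℤ) : Cochains K V V →ₗ[K] Cochains K V V :=
  DirectSum.toModule K ℕ _ fun n =>
    sg K (((n : ℤ) - 1) * e) • DirectSum.lof K ℕ (Cochain K V V) n

theorem signOp_of_mem (e : ℤ) {a : ℤ} {x : Cochains K V V} (hx : x ∈ degreePart K V V a) :
    signOp e x = sg K ((a - 1) * e) • x := by
  rcases eq_zero_or_hom_of_mem hx with rfl | ⟨m, f, rfl, rfl⟩
  · simp
  simp [signOp]

/-- The graded Jacobi identity, read as: bracketing with `x` on the right is a derivation. Putting
the Koszul sign into `signOp` makes the rule linear in `y` and `z`, so it can be iterated as a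
rewrite rule without tracking their degrees. -/
theorem gerstenhaber_leibniz {d : ℤ} {x : Cochains K V V} (hx : x ∈ degreePart K V V d)
    (y z : Cochains K V V) :
    gerstenhaber (gerstenhaber y z) x =
      gerstenhaber y (gerstenhaber z x) + gerstenhaber (gerstenhaber y x) (signOp (d - 1) z) := by
  rcases eq_zero_or_hom_of_mem hx with rfl | ⟨k, h, rfl, rfl⟩
  · simp
  induction y using cochains_induction with
  | zero => simp
  | add y y' hy hy' =>
    simp only [map_add, LinearMap.add_apply, hy, hy']
    abel
  | hom m f =>
    induction z using cochains_induction with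
    | zero => simp
    | add z z' hz hz' =>
      simp only [map_add, LinearMap.add_apply, hz, hz']
      abel
    | hom n g =>
      rw [signOp_of_mem _ (hom_mem g), map_smul, gerstenhaber_jacobi_hom, sg_mul_pred]

theorem signOp_gerstenhaber (e : ℤ) {d : ℤ} {x : Cochains K V V} (hx : x ∈ degreePart K V V d)
    (y : Cochains K V V) :
    signOp e (gerstenhaber y x) = sg K (e * (d - 1)) • gerstenhaber (signOp e y) x := by
  induction y using cochains_induction with
  | zero => simp
  | add y y' hy hy' => simp only [map_add, LinearMap.add_apply, hy, hy', smul_add]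
  | hom m f =>
    rw [signOp_of_mem _ (hom_mem f), signOp_of_mem _ (gerstenhaber_mem (hom_mem f) hx), map_smul,
      LinearMap.smul_apply, smul_smul, ← sg_add]
    congr 2
    ring

theorem gerstenhaber_right_comm {d d' : ℤ} {x x' : Cochains K V V}
    (hx : x ∈ degreePart K V V d) (hx' : x' ∈ degreePart K V V d')
    (h : gerstenhaber x x' = 0) (y : Cochains K V V) :
    gerstenhaber (gerstenhaber y x) x' =
      sg K ((d - 1) * (d' - 1)) • gerstenhaber (gerstenhaber y x') x := by
  rw [gerstenhaber_leibniz hx', h, map_zero, zero_add, signOp_of_mem _ hx, map_smul]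

end Gerstenhaber

/-! ### Brackets with cochains of arity two -/

section Bilinear

variable {K V : Type*} [Field K] [AddCommGroup V] [Module K V]

@[simp]
theorem ofBilin_apply {W : Type*} [AddCommGroup W] [Module K W] (Θ : V →ₗ[K] V →ₗ[K] W)
    (u : Fin 2 → V) : ofBilin Θ u = Θ (u 0) (u 1) := rfl

theorem parallel_ofBilin (Θ : V →ₗ[K] V →ₗ[K] V) {p q : ℕ} (P : Cochain K V V p)
    (Q : Cochain K V V q) (u : ℕ → V) :
    parallel (ofBilin Θ) P Q u = (-1 : K) ^ (p + 1) • evalSeq (hom (cup Θ q p Q P)) u := by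
  rw [evalSeq_hom, cup_apply]
  simp [parallel, Finset.sum_range_succ, insertSeq]
  congr 3
  funext b
  congr 1
  omega

/-- With `P ∘ Q = 0` the left side is the associator of `Θ`, `P`, `Q`. As `Θ` has only two slots, it
consists of the two ways of filling them with `P` and `Q`. -/
theorem comp_circ_ofBilin (Θ : V →ₗ[K] V →ₗ[K] V) {p q : ℕ} (P : Cochain K V V p)
    (Q : Cochain K V V q) (h : circ p q P Q = 0) :
    comp (circ 2 p (ofBilin Θ) P) (hom Q) =
      (-1 : K) ^ (p * (q + 1)) • hom (cup Θ p q P Q) +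
        (-1 : K) ^ (p + 1) • hom (cup Θ q p Q P) := by
  refine cochains_ext fun u => ?_
  have := evalSeq_associator (ofBilin Θ) P Q u
  rw [h, map_zero, map_zero, Pi.zero_apply, sub_zero] at this
  rw [this, parallel_ofBilin, parallel_ofBilin, map_add, map_smul, map_smul, smul_smul, ← pow_add,
    show (p + 1) * (q + 1) + (q + 1) = p * (q + 1) + 2 * (q + 1) by ring,
    pow_add _ _ (2 * (q + 1)), pow_mul _ 2, add_comm]
  simp

/-- In arity two the sign `-(-1)^{3·3}` is `+1`, so the bracket is `Θ ∘ Ξ + Ξ ∘ Θ`; the hypothesis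
is its value on three elements. -/
theorem gerstenhaber_ofBilin_eq_zero (Θ Ξ : V →ₗ[K] V →ₗ[K] V)
    (h : ∀ x y z, Θ (Ξ x y) z - Θ x (Ξ y z) + (Ξ (Θ x y) z - Ξ x (Θ y z)) = 0) :
    gerstenhaber (hom (ofBilin Θ)) (hom (ofBilin Ξ)) = 0 := by
  refine cochains_ext fun u => ?_
  rw [gerstenhaber_hom, map_sub, map_smul, Pi.sub_apply, Pi.smul_apply, evalSeq_circ, evalSeq_circ,
    map_zero, Pi.zero_apply, ← h (u 0) (u 1) (u 2)]
  simp [Fin.sum_univ_two, insertSeq]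
  norm_num
  abel

end Bilinear

/-! ### The abelian subalgebra `L` and the ternary bracket as a derived bracket -/

section Inclusion

variable {K A M : Type*} [Field K] [NonUnitalRing A] [Module K A] [AddCommGroup M] [Module K M]

/-- The extension of `P ∈ Hom(M^{⊗ n}, A)` to `A ⊕ M`. -/
def lift {n : ℕ} (P : Cochain K M A n) : Cochain K (A × M) (A × M) n :=
  ((LinearMap.inl K A M).compMultilinearMap P).compLinearMap fun _ => LinearMap.snd K A M

@[simp]
theorem lift_apply {n : ℕ} (P : Cochain K M A n) (v : Fin n → A × M) :
    lift P v = (P fun a => (v a).2, 0) := rfl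

@[simp]
theorem incl_hom {n : ℕ} (P : Cochain K M A n) : incl K A M (hom P) = hom (lift P) := by
  simp only [incl, DirectSum.toModule_lof]
  rfl

theorem proj_incl (x : Cochains K M A) : proj K A M (incl K A M x) = x := by
  induction x using cochains_induction with
  | zero => simp
  | add x y hx hy => rw [map_add, map_add, hx, hy]
  | hom n P =>
    rw [incl_hom]
    simp only [proj, DirectSum.toModule_lof]
    rfl

theorem incl_injective : Function.Injective (incl K A M) :=
  Function.LeftInverse.injective proj_incl

theorem evalSeq_incl (x : Cochains K M A) (u : ℕ → A × M) :
    evalSeq (incl K A M x) u = (evalSeq x fun a => (u a).2, 0) := by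
  induction x using cochains_induction with
  | zero => simp only [map_zero, Pi.zero_apply, Prod.mk_zero_zero]
  | add x y hx hy => simp [hx, hy]
  | hom n P => simp

theorem incl_mem {d : ℤ} {x : Cochains K M A} (hx : x ∈ degreePart K M A d) :
    incl K A M x ∈ degreePart K (A × M) (A × M) d := by
  rcases eq_zero_or_hom_of_mem hx with rfl | ⟨m, f, rfl, rfl⟩
  · simp
  · rw [incl_hom]
    exact hom_mem _

/-- The extension of `P` sees only the component in `M` of each entry, so the component of `F` in
`A` is irrelevant. -/
theorem circ_lift {p n : ℕ} (P : Cochain K M A p) {F : Cochain K (A × M) (A × M) n}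
    {N : Cochain K M M n} (h : ∀ v, (F v).2 = N fun a => (v a).2) :
    circ p n (lift P) F = incl K A M (circ p n P N) := by
  refine cochains_ext fun u => ?_
  rw [evalSeq_incl, evalSeq_circ, evalSeq_circ]
  have key : ∀ (i : ℕ) (x : A × M) (a : ℕ),
      (insertSeq i n x u a).2 = insertSeq i n x.2 (fun a => (u a).2) a := by
    intro i x a
    simp only [insertSeq]
    split_ifs <;> rfl
  refine Prod.ext ?_ ?_
  · rw [Prod.fst_sum]
    simp [key, h]
  · rw [Prod.snd_sum]
    simp

theorem circ_lift_eq_zero {p n : ℕ} (P : Cochain K M A p) {F : Cochain K (A × M) (A × M) n}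
    (h : ∀ v, (F v).2 = 0) : circ p n (lift P) F = 0 := by
  rw [circ_lift (N := 0) P (by simpa using h), map_zero, map_zero]

theorem comp_lift_circ_lift {p q n : ℕ} (P : Cochain K M A p) (Q : Cochain K M A q)
    (F : Cochain K (A × M) (A × M) n) : comp (hom (lift P)) (circ q n (lift Q) F) = 0 := by
  rw [circ_eq_sum, map_sum]
  refine Finset.sum_eq_zero fun i _ => ?_
  rw [map_smul, comp_hom, circ_lift_eq_zero P (fun v => rfl), smul_zero]

theorem circ_lift_lift {p q : ℕ} (P : Cochain K M A p) (Q : Cochain K M A q) :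
    circ p q (lift P) (lift Q) = 0 :=
  circ_lift_eq_zero P fun _ => rfl

/-- Here `F` ignores components in `A`, while the extension of `Q` takes values in `A`; each
insertion amounts to a zero entry. -/
theorem circ_lift_right_eq_zero {m n : ℕ} {F : Cochain K (A × M) (A × M) m}
    (Q : Cochain K M A n) (h : ∀ v, F v = F fun a => (0, (v a).2)) : circ m n F (lift Q) = 0 := by
  refine cochains_ext fun u => ?_
  rw [evalSeq_circ, map_zero, Pi.zero_apply]
  refine Finset.sum_eq_zero fun i _ => ?_
  rw [h, F.map_coord_zero i (by simp [insertSeq]), smul_zero]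

/-- Values lie in `A` and entries are read in `M`, so both compositions vanish: `L` is abelian. -/
theorem gerstenhaber_incl_incl (x y : Cochains K M A) :
    gerstenhaber (incl K A M x) (incl K A M y) = 0 := by
  induction x using cochains_induction with
  | zero => simp
  | add x x' hx hx' => simp [hx, hx']
  | hom p P =>
    induction y using cochains_induction with
    | zero => simp
    | add y y' hy hy' => simp only [map_add, hy, hy', add_zero]
    | hom q Q =>
      rw [incl_hom, incl_hom, gerstenhaber_hom, circ_lift_lift, circ_lift_lift, smul_zero, sub_zero]

/-- By the pre-Lie identity the associator equals, up to sign, the one with `F` and `R` exchanged,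
and there both terms vanish because the value of `R` lies in `A`. -/
theorem comp_circ_lift {p n r : ℕ} (P : Cochain K M A p) (F : Cochain K (A × M) (A × M) n)
    (R : Cochain K M A r) :
    comp (circ p n (lift P) F) (hom (lift R)) = comp (hom (lift P)) (circ n r F (lift R)) := by
  have h := comp_preLie (lift P) F (lift R)
  rwa [circ_lift_lift, comp_lift_circ_lift, map_zero, LinearMap.zero_apply, sub_zero, smul_zero,
    sub_eq_zero] at h

theorem gerstenhaber_comp_lift {p r : ℕ} (P : Cochain K M A p) (R : Cochain K M A r)
    (y : Cochains K (A × M) (A × M)) :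
    gerstenhaber (comp (hom (lift P)) y) (hom (lift R)) =
      comp (hom (lift P)) (comp y (hom (lift R))) := by
  induction y using cochains_induction with
  | zero => simp
  | add y y' hy hy' => simp only [map_add, LinearMap.add_apply, hy, hy']
  | hom n F =>
    rw [comp_hom, comp_hom, gerstenhaber_circ_left, comp_lift_circ_lift, smul_zero, sub_zero,
      comp_circ_lift]

/-- Of the four compositions in the double bracket, `Q ∘ (P ∘ Θ)` vanishes, and `(P ∘ Θ) ∘ Q`
reassociates to `P ∘ (Θ ∘ Q)`. -/
theorem gerstenhaber_gerstenhaber_lift (Θ : (A × M) →ₗ[K] (A × M) →ₗ[K] (A × M)) {p q : ℕ}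
    (P : Cochain K M A p) (Q : Cochain K M A q) :
    gerstenhaber (gerstenhaber (hom (ofBilin Θ)) (hom (lift P))) (hom (lift Q)) =
      comp (circ 2 p (ofBilin Θ) (lift P)) (hom (lift Q)) +
      (-1 : K) ^ p • comp (hom (lift P)) (circ 2 q (ofBilin Θ) (lift Q)) -
      (-1 : K) ^ (p * (q + 1)) • comp (hom (lift Q)) (circ 2 p (ofBilin Θ) (lift P)) := by
  have h1 : (-1 : K) ^ ((2 + 1) * (p + 1)) = -(-1) ^ p := by
    rw [mul_add, pow_add, pow_mul]; norm_num
  have h2 : (-1 : K) ^ ((2 + 1) * (q + 1)) * (-1) ^ ((p + 1) * (q + 1)) =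
      (-1) ^ (p * (q + 1)) := by
    rw [← pow_add, show (2 + 1) * (q + 1) + (p + 1) * (q + 1) =
      p * (q + 1) + 2 * (2 * (q + 1)) by ring, pow_add _ _ (2 * _), pow_mul _ 2]
    simp
  rw [gerstenhaber_hom, map_sub, map_smul, LinearMap.sub_apply, LinearMap.smul_apply,
    gerstenhaber_circ_left, ← comp_hom (lift P), gerstenhaber_comp_lift, comp_hom, h1, h2]
  module

/-- The map `((a, u), (b, v)) ↦ (0, H(a, b))` on `A ⊕ M`. -/
def bilinLift (H : A →ₗ[K] A →ₗ[K] M) : (A × M) →ₗ[K] (A × M) →ₗ[K] (A × M) :=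
  (H.compl₁₂ (LinearMap.fst K A M) (LinearMap.fst K A M)).compr₂ (LinearMap.inr K A M)

@[simp]
theorem bilinLift_apply (H : A →ₗ[K] A →ₗ[K] M) (x y : A × M) :
    bilinLift H x y = (0, H x.1 y.1) := rfl

theorem incl_ternaryTerm (H : A →ₗ[K] A →ₗ[K] M) {p q r : ℕ}
    (P : Cochain K M A p) (Q : Cochain K M A q) (R : Cochain K M A r) :
    incl K A M (ternaryTerm H P Q R) = -((-1 : K) ^ (p + q * r) •
      circ p (q + r) (lift P) (cup (bilinLift H) q r (lift Q) (lift R))) := by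
  rw [ternaryTerm, map_neg, map_smul, circ_lift (N := cup H q r Q R)]
  intro v
  simp [cup_apply]

theorem gerstenhaber_cup_bilinLift (H : A →ₗ[K] A →ₗ[K] M) {p q r : ℕ}
    (P : Cochain K M A p) (Q : Cochain K M A q) (R : Cochain K M A r) :
    gerstenhaber (hom (cup (bilinLift H) p q (lift P) (lift Q))) (hom (lift R)) =
      -((-1 : K) ^ ((p + q + 1) * (r + 1)) •
        circ r (p + q) (lift R) (cup (bilinLift H) p q (lift P) (lift Q))) := by
  rw [gerstenhaber_hom, circ_lift_right_eq_zero, zero_sub]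
  intro v
  simp [cup_apply]

/-- The six terms of the ternary bracket are exactly the terms of the triple bracket. Of the double
bracket, the parts `H(P, Q)` and `H(Q, P)` contribute `R ∘ H(-, -)`, and the parts `P ∘ (η ∘ Q)` and
`Q ∘ (η ∘ P)` contribute two terms each. The signs depend only on the parities of `p`, `q`, `r`. -/
theorem incl_ternaryBracket_hom (H : A →ₗ[K] A →ₗ[K] M) {p q r : ℕ}
    (P : Cochain K M A p) (Q : Cochain K M A q) (R : Cochain K M A r) :
    incl K A M (ternaryBracket H (hom P) (hom Q) (hom R)) = -(-1 : K) ^ q •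
      gerstenhaber (gerstenhaber (gerstenhaber (hom (ofBilin (bilinLift H)))
        (incl K A M (hom P))) (incl K A M (hom Q))) (incl K A M (hom R)) := by
  have h : ternaryBracket H (hom P) (hom Q) (hom R) = ternaryTerm H P Q R
      - (-1 : K) ^ (q * r) • ternaryTerm H P R Q
      - (-1 : K) ^ (p * q) • ternaryTerm H Q P R
      + (-1 : K) ^ (p * (q + r)) • ternaryTerm H Q R P
      - (-1 : K) ^ (p * q + q * r + r * p) • ternaryTerm H R Q P
      + (-1 : K) ^ ((p + q) * r) • ternaryTerm H R P Q :=
    extend₃_hom _ P Q R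
  rw [h]
  simp only [map_add, map_sub, map_smul, incl_ternaryTerm, incl_hom,
    gerstenhaber_gerstenhaber_lift, LinearMap.add_apply, LinearMap.sub_apply,
    LinearMap.smul_apply, gerstenhaber_comp_lift]
  simp only [comp_circ_ofBilin, circ_lift_lift, map_add, map_smul, LinearMap.add_apply,
    LinearMap.smul_apply, gerstenhaber_cup_bilinLift, comp_hom]
  rcases Nat.even_or_odd p with hp | hp <;> rcases Nat.even_or_odd q with hq | hq <;>
  rcases Nat.even_or_odd r with hr | hr <;>
  simp [pow_add, pow_mul, mul_add, add_mul, hp.neg_one_pow, hq.neg_one_pow, hr.neg_one_pow] <;>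
  module

theorem incl_ternaryBracket (H : A →ₗ[K] A →ₗ[K] M) {d e f : ℤ} {x y z : Cochains K M A}
    (hx : x ∈ degreePart K M A d) (hy : y ∈ degreePart K M A e) (hz : z ∈ degreePart K M A f) :
    incl K A M (ternaryBracket H x y z) = -sg K e •
      gerstenhaber (gerstenhaber (gerstenhaber (hom (ofBilin (bilinLift H))) (incl K A M x))
        (incl K A M y)) (incl K A M z) := by
  rcases eq_zero_or_hom_of_mem hx with rfl | ⟨p, P, rfl, rfl⟩
  · simp
  rcases eq_zero_or_hom_of_mem hy with rfl | ⟨q, Q, rfl, rfl⟩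
  · simp
  rcases eq_zero_or_hom_of_mem hz with rfl | ⟨r, R, rfl, rfl⟩
  · simp
  rw [incl_ternaryBracket_hom, sg_natCast]

/-- The map `η` takes values in `M` and vanishes when an entry lies in `M`. -/
theorem gerstenhaber_bilinLift_self (H : A →ₗ[K] A →ₗ[K] M) :
    gerstenhaber (hom (ofBilin (bilinLift H))) (hom (ofBilin (bilinLift H))) = 0 :=
  gerstenhaber_ofBilin_eq_zero _ _ fun x y z => by simp

end Inclusion

/-! ### The binary bracket stays in `L`; the structure equations for `Θ` and `η` -/

section Derived

variable {K A M : Type*} [Field K] [NonUnitalRing A] [Module K A]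
  [IsScalarTower K A A] [SMulCommClass K A A] [AddCommGroup M] [Module K M]

theorem comp_lift_circ_semidirect_mem (B : Bimod K A M) {p q : ℕ}
    (P : Cochain K M A p) (Q : Cochain K M A q) :
    comp (hom (lift P)) (circ 2 q (ofBilin (semidirect B)) (lift Q)) ∈
      LinearMap.range (incl K A M) := by
  rw [circ_eq_sum, map_sum]
  refine Submodule.sum_mem _ fun i _ => ?_
  rw [map_smul, comp_hom]
  refine Submodule.smul_mem _ _ ?_
  -- With `Q` in one slot and `(b, v)` in the other, `b` only multiplies `Q` inside `A`. The
  -- component in `M` is `Q · v` or `v · Q`, so it may be computed after restriction to `M`.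
  rw [circ_lift (N := ((LinearMap.snd K A M).compMultilinearMap
    (insertion (ofBilin (semidirect B)) (lift Q) i)).compLinearMap fun _ => LinearMap.inr K A M)]
  · exact LinearMap.mem_range_self _ _
  · intro v
    change (ofBilin (semidirect B) (insertArgs i (lift Q) v)).2 =
      (ofBilin (semidirect B) (insertArgs i (lift Q) fun a => (0, (v a).2))).2
    fin_cases i <;> simp [insertArgs, semidirect_apply]

theorem cup_semidirect (B : Bimod K A M) {p q : ℕ} (P : Cochain K M A p) (Q : Cochain K M A q) :
    cup (semidirect B) p q (lift P) (lift Q) = lift (cup (LinearMap.mul K A) p q P Q) := by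
  ext v <;> simp [cup_apply, semidirect_apply]

/-- In the expansion, two terms are products in `A` of values of `P` and `Q`, and two have the
extension of `P` or `Q` outermost; each lies in `L`. -/
theorem gerstenhaber_semidirect_mem (B : Bimod K A M) {p q : ℕ}
    (P : Cochain K M A p) (Q : Cochain K M A q) :
    gerstenhaber (gerstenhaber (hom (ofBilin (semidirect B))) (hom (lift P))) (hom (lift Q)) ∈
      LinearMap.range (incl K A M) := by
  rw [gerstenhaber_gerstenhaber_lift, comp_circ_ofBilin _ _ _ (circ_lift_lift P Q),
    cup_semidirect, cup_semidirect, ← incl_hom, ← incl_hom]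
  refine Submodule.sub_mem _ (Submodule.add_mem _ (Submodule.add_mem _ ?_ ?_) ?_) ?_ <;>
  refine Submodule.smul_mem _ _ ?_
  · exact LinearMap.mem_range_self _ _
  · exact LinearMap.mem_range_self _ _
  · exact comp_lift_circ_semidirect_mem B P Q
  · exact comp_lift_circ_semidirect_mem B Q P

theorem incl_derivedBracket_hom (B : Bimod K A M) {p q : ℕ}
    (P : Cochain K M A p) (Q : Cochain K M A q) :
    incl K A M (derivedBracket B (hom P) (hom Q)) = (-1 : K) ^ p •
      gerstenhaber (gerstenhaber (hom (ofBilin (semidirect B))) (incl K A M (hom P)))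
        (incl K A M (hom Q)) := by
  have h : derivedBracket B (hom P) (hom Q) = (-1 : K) ^ p • proj K A M
      (gerstenhaber (gerstenhaber (hom (ofBilin (semidirect B))) (incl K A M (hom P)))
        (incl K A M (hom Q))) :=
    extend₂_hom _ P Q
  rw [h, map_smul]
  congr 1
  obtain ⟨x, hx⟩ := gerstenhaber_semidirect_mem B P Q
  -- Since the double bracket already lies in `L`, the projection in the definition loses nothing.
  rw [incl_hom, incl_hom, ← hx, proj_incl]

theorem incl_derivedBracket (B : Bimod K A M) {d e : ℤ} {x y : Cochains K M A}
    (hx : x ∈ degreePart K M A d) (hy : y ∈ degreePart K M A e) :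
    incl K A M (derivedBracket B x y) = sg K d •
      gerstenhaber (gerstenhaber (hom (ofBilin (semidirect B))) (incl K A M x))
        (incl K A M y) := by
  rcases eq_zero_or_hom_of_mem hx with rfl | ⟨p, P, rfl, rfl⟩
  · simp
  rcases eq_zero_or_hom_of_mem hy with rfl | ⟨q, Q, rfl, rfl⟩
  · simp
  rw [incl_derivedBracket_hom, sg_natCast]

theorem gerstenhaber_semidirect_self (B : Bimod K A M) :
    gerstenhaber (hom (ofBilin (semidirect B))) (hom (ofBilin (semidirect B))) = 0 := by
  have h : ∀ x y z, semidirect B (semidirect B x y) z = semidirect B x (semidirect B y z) := by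
    intro x y z
    simp [semidirect_apply, mul_assoc, B.mul_left, B.left_right, B.right_mul, add_assoc]
  refine gerstenhaber_ofBilin_eq_zero _ _ fun x y z => ?_
  simp [h]

/-- The component in `A` is zero, and the component in `M` is minus the left side of the cocycle
condition. -/
theorem gerstenhaber_semidirect_bilinLift {B : Bimod K A M} {H : A →ₗ[K] A →ₗ[K] M}
    (hH : IsHochschildTwoCocycle B H) :
    gerstenhaber (hom (ofBilin (semidirect B))) (hom (ofBilin (bilinLift H))) = 0 := by
  refine gerstenhaber_ofBilin_eq_zero _ _ fun x y z => ?_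
  have h := hH x.1 y.1 z.1
  refine Prod.ext (by simp [semidirect_apply]) ?_
  rw [Prod.snd_zero, ← neg_eq_zero, ← h]
  simp [semidirect_apply]
  abel

end Derived

/-! ### Explicit sums over unshuffles -/

section Unshuffles

variable {K X : Type*} [Field K] [AddCommGroup X] [Module K X]

/-- The permutation with values `f` and inverse `g`. -/
abbrev permOf {n : ℕ} (f g : Fin n → Fin n) (h : ∀ a, g (f a) = a) (h' : ∀ a, f (g a) = a) :
    Equiv.Perm (Fin n) := ⟨f, g, h, h'⟩

theorem sg_sum {ι : Type*} (s : Finset ι) (f : ι → ℤ) :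
    sg K (∑ i ∈ s, f i) = ∏ i ∈ s, sg K (f i) := by
  classical
  induction s using Finset.induction_on with
  | empty => simp [sg]
  | insert a s ha ih => rw [Finset.sum_insert ha, Finset.prod_insert ha, sg_add, ih]

theorem sign_eq_prod_inversions {n : ℕ} (σ : Equiv.Perm (Fin n)) :
    Equiv.Perm.sign σ = ∏ p : Fin n × Fin n, if p.1 < p.2 ∧ σ p.2 < σ p.1 then -1 else 1 := by
  rw [Equiv.Perm.sign_eq_prod_prod_Ioi, Fintype.prod_prod_type]
  refine Finset.prod_congr rfl fun i _ => ?_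
  rw [← Finset.prod_subset (Finset.subset_univ (Finset.Ioi i))]
  · refine Finset.prod_congr rfl fun j hj => ?_
    have hij := Finset.mem_Ioi.mp hj
    have hne : σ i ≠ σ j := fun h => hij.ne (σ.injective h)
    rcases lt_or_gt_of_ne hne with h | h
    · simp [h, h.le]
    · simp [h, h.le, hij]
  · intro j _ hj
    rw [Finset.mem_Ioi] at hj
    simp [hj]

/-- Each inversion contributes `-1` to the signature and `(-1)^{d d'}` to the Koszul sign, so the
combined sign has one exponent, additive over inversions. -/
theorem sign_mul_koszulSign {n : ℕ} (d : Fin n → ℤ) (σ : Equiv.Perm (Fin n)) :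
    ((Equiv.Perm.sign σ * koszulSign d σ : ℤˣ) : ℤ) = (sg K (∑ p : Fin n × Fin n,
      if p.1 < p.2 ∧ σ p.2 < σ p.1 then 1 + d (σ p.1) * d (σ p.2) else 0) : K) := by
  have h : Equiv.Perm.sign σ * koszulSign d σ = ∏ p : Fin n × Fin n,
      if p.1 < p.2 ∧ σ p.2 < σ p.1 then (1 + d (σ p.1) * d (σ p.2)).negOnePow else 1 := by
    rw [sign_eq_prod_inversions, koszulSign, ← Finset.prod_mul_distrib]
    refine Finset.prod_congr rfl fun p _ => ?_
    split_ifs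
    · rw [Int.negOnePow_add, Int.negOnePow_one]
    · rw [one_mul]
  rw [h, sg_sum]
  push_cast
  refine Finset.prod_congr rfl fun p _ => ?_
  split_ifs <;> simp [sg]

theorem isUnshuffle_three_two (σ : Equiv.Perm (Fin 3)) : IsUnshuffle 2 σ ↔ σ ∈ ({
      permOf ![0, 1, 2] ![0, 1, 2] (by decide) (by decide),
      permOf ![0, 2, 1] ![0, 2, 1] (by decide) (by decide),
      permOf ![1, 2, 0] ![2, 0, 1] (by decide) (by decide)} :
        Finset (Equiv.Perm (Fin 3))) := by
  -- Restated with `IsUnshuffle` unfolded, the claim is decidable and is checked over all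
  -- permutations.
  have h : ∀ (τ : Equiv.Perm (Fin 3)),
      (∀ a b : Fin 3, a < b → (b.val < 2 ∨ 2 ≤ a.val) → τ a < τ b) ↔
      τ ∈ ({
      permOf ![0, 1, 2] ![0, 1, 2] (by decide) (by decide),
      permOf ![0, 2, 1] ![0, 2, 1] (by decide) (by decide),
      permOf ![1, 2, 0] ![2, 0, 1] (by decide) (by decide)} :
        Finset (Equiv.Perm (Fin 3))) := by
    decide +kernel
  exact h σ

theorem sum_unshuffle_three_two (d : Fin 3 → ℤ) (G : Fin 3 → Fin 3 → Fin 3 → X)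
    [DecidablePred (IsUnshuffle (n := 3) 2)] :
    ∑ σ : Equiv.Perm (Fin 3) with IsUnshuffle 2 σ,
      (Equiv.Perm.sign σ * koszulSign d σ) • G (σ 0) (σ 1) (σ 2) =
    sg K (0) • G 0 1 2 +
    sg K ((1 + d 2 * d 1)) • G 0 2 1 +
    sg K ((1 + d 1 * d 0) + (1 + d 2 * d 0)) • G 1 2 0 := by
  simp only [units_smul_eq (K := K), sign_mul_koszulSign]
  rw [Finset.filter_congr fun σ _ => isUnshuffle_three_two σ, Finset.filter_mem_eq_inter,
    Finset.univ_inter]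
  rw [Finset.sum_insert (by decide +kernel), Finset.sum_insert (by decide +kernel),
    Finset.sum_singleton]
  simp [Fintype.sum_prod_type, Fin.sum_univ_succ, add_assoc]

theorem isUnshuffle_four_two (σ : Equiv.Perm (Fin 4)) : IsUnshuffle 2 σ ↔ σ ∈ ({
      permOf ![0, 1, 2, 3] ![0, 1, 2, 3] (by decide) (by decide),
      permOf ![0, 2, 1, 3] ![0, 2, 1, 3] (by decide) (by decide),
      permOf ![0, 3, 1, 2] ![0, 2, 3, 1] (by decide) (by decide),
      permOf ![1, 2, 0, 3] ![2, 0, 1, 3] (by decide) (by decide),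
      permOf ![1, 3, 0, 2] ![2, 0, 3, 1] (by decide) (by decide),
      permOf ![2, 3, 0, 1] ![2, 3, 0, 1] (by decide) (by decide)} :
        Finset (Equiv.Perm (Fin 4))) := by
  have h : ∀ (τ : Equiv.Perm (Fin 4)),
      (∀ a b : Fin 4, a < b → (b.val < 2 ∨ 2 ≤ a.val) → τ a < τ b) ↔
      τ ∈ ({
      permOf ![0, 1, 2, 3] ![0, 1, 2, 3] (by decide) (by decide),
      permOf ![0, 2, 1, 3] ![0, 2, 1, 3] (by decide) (by decide),
      permOf ![0, 3, 1, 2] ![0, 2, 3, 1] (by decide) (by decide),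
      permOf ![1, 2, 0, 3] ![2, 0, 1, 3] (by decide) (by decide),
      permOf ![1, 3, 0, 2] ![2, 0, 3, 1] (by decide) (by decide),
      permOf ![2, 3, 0, 1] ![2, 3, 0, 1] (by decide) (by decide)} :
        Finset (Equiv.Perm (Fin 4))) := by
    decide +kernel
  exact h σ

theorem sum_unshuffle_four_two (d : Fin 4 → ℤ) (G : Fin 4 → Fin 4 → Fin 4 → Fin 4 → X)
    [DecidablePred (IsUnshuffle (n := 4) 2)] :
    ∑ σ : Equiv.Perm (Fin 4) with IsUnshuffle 2 σ,
      (Equiv.Perm.sign σ * koszulSign d σ) • G (σ 0) (σ 1) (σ 2) (σ 3) =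
    sg K (0) • G 0 1 2 3 +
    sg K ((1 + d 2 * d 1)) • G 0 2 1 3 +
    sg K ((1 + d 3 * d 1) + (1 + d 3 * d 2)) • G 0 3 1 2 +
    sg K ((1 + d 1 * d 0) + (1 + d 2 * d 0)) • G 1 2 0 3 +
    sg K ((1 + d 1 * d 0) + (1 + d 3 * d 0) + (1 + d 3 * d 2)) • G 1 3 0 2 +
    sg K ((1 + d 2 * d 0) + (1 + d 2 * d 1) + (1 + d 3 * d 0) + (1 + d 3 * d 1)) • G 2 3 0 1 := by
  simp only [units_smul_eq (K := K), sign_mul_koszulSign]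
  rw [Finset.filter_congr fun σ _ => isUnshuffle_four_two σ, Finset.filter_mem_eq_inter,
    Finset.univ_inter]
  rw [Finset.sum_insert (by decide +kernel), Finset.sum_insert (by decide +kernel),
    Finset.sum_insert (by decide +kernel), Finset.sum_insert (by decide +kernel),
    Finset.sum_insert (by decide +kernel), Finset.sum_singleton]
  simp [Fintype.sum_prod_type, Fin.sum_univ_succ, add_assoc]

theorem isUnshuffle_four_three (σ : Equiv.Perm (Fin 4)) : IsUnshuffle 3 σ ↔ σ ∈ ({
      permOf ![0, 1, 2, 3] ![0, 1, 2, 3] (by decide) (by decide),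
      permOf ![0, 1, 3, 2] ![0, 1, 3, 2] (by decide) (by decide),
      permOf ![0, 2, 3, 1] ![0, 3, 1, 2] (by decide) (by decide),
      permOf ![1, 2, 3, 0] ![3, 0, 1, 2] (by decide) (by decide)} :
        Finset (Equiv.Perm (Fin 4))) := by
  have h : ∀ (τ : Equiv.Perm (Fin 4)),
      (∀ a b : Fin 4, a < b → (b.val < 3 ∨ 3 ≤ a.val) → τ a < τ b) ↔
      τ ∈ ({
      permOf ![0, 1, 2, 3] ![0, 1, 2, 3] (by decide) (by decide),
      permOf ![0, 1, 3, 2] ![0, 1, 3, 2] (by decide) (by decide),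
      permOf ![0, 2, 3, 1] ![0, 3, 1, 2] (by decide) (by decide),
      permOf ![1, 2, 3, 0] ![3, 0, 1, 2] (by decide) (by decide)} :
        Finset (Equiv.Perm (Fin 4))) := by
    decide +kernel
  exact h σ

theorem sum_unshuffle_four_three (d : Fin 4 → ℤ) (G : Fin 4 → Fin 4 → Fin 4 → Fin 4 → X)
    [DecidablePred (IsUnshuffle (n := 4) 3)] :
    ∑ σ : Equiv.Perm (Fin 4) with IsUnshuffle 3 σ,
      (Equiv.Perm.sign σ * koszulSign d σ) • G (σ 0) (σ 1) (σ 2) (σ 3) =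
    sg K (0) • G 0 1 2 3 +
    sg K ((1 + d 3 * d 2)) • G 0 1 3 2 +
    sg K ((1 + d 2 * d 1) + (1 + d 3 * d 1)) • G 0 2 3 1 +
    sg K ((1 + d 1 * d 0) + (1 + d 2 * d 0) + (1 + d 3 * d 0)) • G 1 2 3 0 := by
  simp only [units_smul_eq (K := K), sign_mul_koszulSign]
  rw [Finset.filter_congr fun σ _ => isUnshuffle_four_three σ, Finset.filter_mem_eq_inter,
    Finset.univ_inter]
  rw [Finset.sum_insert (by decide +kernel), Finset.sum_insert (by decide +kernel),
    Finset.sum_insert (by decide +kernel), Finset.sum_singleton]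
  simp [Fintype.sum_prod_type, Fin.sum_univ_succ, add_assoc]

theorem isUnshuffle_five_three (σ : Equiv.Perm (Fin 5)) : IsUnshuffle 3 σ ↔ σ ∈ ({
      permOf ![0, 1, 2, 3, 4] ![0, 1, 2, 3, 4] (by decide) (by decide),
      permOf ![0, 1, 3, 2, 4] ![0, 1, 3, 2, 4] (by decide) (by decide),
      permOf ![0, 1, 4, 2, 3] ![0, 1, 3, 4, 2] (by decide) (by decide),
      permOf ![0, 2, 3, 1, 4] ![0, 3, 1, 2, 4] (by decide) (by decide),
      permOf ![0, 2, 4, 1, 3] ![0, 3, 1, 4, 2] (by decide) (by decide),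
      permOf ![0, 3, 4, 1, 2] ![0, 3, 4, 1, 2] (by decide) (by decide),
      permOf ![1, 2, 3, 0, 4] ![3, 0, 1, 2, 4] (by decide) (by decide),
      permOf ![1, 2, 4, 0, 3] ![3, 0, 1, 4, 2] (by decide) (by decide),
      permOf ![1, 3, 4, 0, 2] ![3, 0, 4, 1, 2] (by decide) (by decide),
      permOf ![2, 3, 4, 0, 1] ![3, 4, 0, 1, 2] (by decide) (by decide)} :
        Finset (Equiv.Perm (Fin 5))) := by
  have h : ∀ (τ : Equiv.Perm (Fin 5)),
      (∀ a b : Fin 5, a < b → (b.val < 3 ∨ 3 ≤ a.val) → τ a < τ b) ↔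
      τ ∈ ({
      permOf ![0, 1, 2, 3, 4] ![0, 1, 2, 3, 4] (by decide) (by decide),
      permOf ![0, 1, 3, 2, 4] ![0, 1, 3, 2, 4] (by decide) (by decide),
      permOf ![0, 1, 4, 2, 3] ![0, 1, 3, 4, 2] (by decide) (by decide),
      permOf ![0, 2, 3, 1, 4] ![0, 3, 1, 2, 4] (by decide) (by decide),
      permOf ![0, 2, 4, 1, 3] ![0, 3, 1, 4, 2] (by decide) (by decide),
      permOf ![0, 3, 4, 1, 2] ![0, 3, 4, 1, 2] (by decide) (by decide),
      permOf ![1, 2, 3, 0, 4] ![3, 0, 1, 2, 4] (by decide) (by decide),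
      permOf ![1, 2, 4, 0, 3] ![3, 0, 1, 4, 2] (by decide) (by decide),
      permOf ![1, 3, 4, 0, 2] ![3, 0, 4, 1, 2] (by decide) (by decide),
      permOf ![2, 3, 4, 0, 1] ![3, 4, 0, 1, 2] (by decide) (by decide)} :
        Finset (Equiv.Perm (Fin 5))) := by
    decide +kernel
  exact h σ

theorem sum_unshuffle_five_three (d : Fin 5 → ℤ) (G : Fin 5 → Fin 5 → Fin 5 → Fin 5 → Fin 5 → X)
    [DecidablePred (IsUnshuffle (n := 5) 3)] :
    ∑ σ : Equiv.Perm (Fin 5) with IsUnshuffle 3 σ,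
      (Equiv.Perm.sign σ * koszulSign d σ) • G (σ 0) (σ 1) (σ 2) (σ 3) (σ 4) =
    sg K (0) • G 0 1 2 3 4 +
    sg K ((1 + d 3 * d 2)) • G 0 1 3 2 4 +
    sg K ((1 + d 4 * d 2) + (1 + d 4 * d 3)) • G 0 1 4 2 3 +
    sg K ((1 + d 2 * d 1) + (1 + d 3 * d 1)) • G 0 2 3 1 4 +
    sg K ((1 + d 2 * d 1) + (1 + d 4 * d 1) + (1 + d 4 * d 3)) • G 0 2 4 1 3 +
    sg K ((1 + d 3 * d 1) + (1 + d 3 * d 2) + (1 + d 4 * d 1) + (1 + d 4 * d 2)) • G 0 3 4 1 2 +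
    sg K ((1 + d 1 * d 0) + (1 + d 2 * d 0) + (1 + d 3 * d 0)) • G 1 2 3 0 4 +
    sg K ((1 + d 1 * d 0) + (1 + d 2 * d 0) + (1 + d 4 * d 0) + (1 + d 4 * d 3)) • G 1 2 4 0 3 +
    sg K ((1 + d 1 * d 0) + (1 + d 3 * d 0) + (1 + d 3 * d 2) + (1 + d 4 * d 0) + (1 + d 4 * d 2)) • G 1 3 4 0 2 +
    sg K ((1 + d 2 * d 0) + (1 + d 2 * d 1) + (1 + d 3 * d 0) + (1 + d 3 * d 1) + (1 + d 4 * d 0) + (1 + d 4 * d 1)) • G 2 3 4 0 1 := by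
  simp only [units_smul_eq (K := K), sign_mul_koszulSign]
  rw [Finset.filter_congr fun σ _ => isUnshuffle_five_three σ, Finset.filter_mem_eq_inter,
    Finset.univ_inter]
  rw [Finset.sum_insert (by decide +kernel), Finset.sum_insert (by decide +kernel),
    Finset.sum_insert (by decide +kernel), Finset.sum_insert (by decide +kernel),
    Finset.sum_insert (by decide +kernel), Finset.sum_insert (by decide +kernel),
    Finset.sum_insert (by decide +kernel), Finset.sum_insert (by decide +kernel),
    Finset.sum_insert (by decide +kernel), Finset.sum_singleton]
  simp [Fintype.sum_prod_type, Fin.sum_univ_succ, add_assoc]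

end Unshuffles

/-! ### Evaluating signs by parity -/

section SignEvaluation

variable {K : Type*} [Field K]

theorem sg_sub (a b : ℤ) : sg K (a - b) = sg K a * sg K b := by
  rw [← sg_add]
  exact sg_congr ⟨-b, by ring⟩

theorem sg_zero : sg K 0 = 1 := sg_even (by decide)

theorem sg_one : sg K 1 = -1 := sg_odd (by decide)

theorem sg_two : sg K 2 = 1 := sg_even (by decide)

theorem sg_mul_two (a : ℤ) : sg K (a * 2) = 1 := sg_even (even_two.mul_left a)

theorem sg_two_mul (a : ℤ) : sg K (2 * a) = 1 := sg_even (even_two.mul_right a)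

variable (K) in
-- In either case the equations serve as rewrite rules on sign exponents: an even factor makes the
-- sign of a monomial trivial, and an odd factor can be dropped.
theorem sg_parity (d : ℤ) :
    (sg K d = 1 ∧ (∀ a, sg K (a * d) = 1) ∧ ∀ a, sg K (d * a) = 1) ∨
    (sg K d = -1 ∧ (∀ a, sg K (a * d) = sg K a) ∧ ∀ a, sg K (d * a) = sg K a) := by
  rcases Int.even_or_odd d with h | h
  · exact Or.inl ⟨sg_even h, fun a => sg_even (h.mul_left a), fun a => sg_even (h.mul_right a)⟩
  · obtain ⟨k, rfl⟩ := h
    exact Or.inr ⟨sg_odd ⟨k, rfl⟩, fun a => sg_congr ⟨a * k, by ring⟩,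
      fun a => sg_congr ⟨a * k, by ring⟩⟩

end SignEvaluation

/-! ### Degrees of the brackets -/

section Degrees

variable {K A M : Type*} [Field K] [NonUnitalRing A] [Module K A] [AddCommGroup M] [Module K M]

theorem proj_mem {d : ℤ} {x : Cochains K (A × M) (A × M)}
    (hx : x ∈ degreePart K (A × M) (A × M) d) : proj K A M x ∈ degreePart K M A d := by
  rcases eq_zero_or_hom_of_mem hx with rfl | ⟨m, f, rfl, rfl⟩
  · simp
  · simp only [proj, DirectSum.toModule_lof]
    exact hom_mem _

theorem mem_of_incl_mem {d : ℤ} {x : Cochains K M A}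
    (hx : incl K A M x ∈ degreePart K (A × M) (A × M) d) : x ∈ degreePart K M A d := by
  rw [← proj_incl x]
  exact proj_mem hx

theorem ternaryBracket_mem (H : A →ₗ[K] A →ₗ[K] M) {d e f : ℤ} {x y z : Cochains K M A}
    (hx : x ∈ degreePart K M A d) (hy : y ∈ degreePart K M A e) (hz : z ∈ degreePart K M A f) :
    ternaryBracket H x y z ∈ degreePart K M A (d + e + f - 1) := by
  apply mem_of_incl_mem
  rw [incl_ternaryBracket H hx hy hz]
  have h := gerstenhaber_mem (gerstenhaber_mem (gerstenhaber_mem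
    (hom_mem (ofBilin (bilinLift H))) (incl_mem hx)) (incl_mem hy)) (incl_mem hz)
  rw [show ((2 : ℕ) : ℤ) + d - 1 + e - 1 + f - 1 = d + e + f - 1 by push_cast; ring] at h
  exact Submodule.smul_mem _ _ h

variable [IsScalarTower K A A] [SMulCommClass K A A]

theorem derivedBracket_mem (B : Bimod K A M) {d e : ℤ} {x y : Cochains K M A}
    (hx : x ∈ degreePart K M A d) (hy : y ∈ degreePart K M A e) :
    derivedBracket B x y ∈ degreePart K M A (d + e) := by
  apply mem_of_incl_mem
  rw [incl_derivedBracket B hx hy]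
  have h := gerstenhaber_mem (gerstenhaber_mem
    (hom_mem (ofBilin (semidirect B))) (incl_mem hx)) (incl_mem hy)
  rw [show ((2 : ℕ) : ℤ) + d - 1 + e - 1 = d + e by push_cast; ring] at h
  exact Submodule.smul_mem _ _ h

end Degrees

/-! ### Composites of two brackets as brackets in the large algebra -/

section Composites

variable {K A M : Type*} [Field K] [NonUnitalRing A] [Module K A] [AddCommGroup M] [Module K M]

theorem gerstenhaber_incl_right_comm {d e : ℤ} {x y : Cochains K M A}
    (hx : x ∈ degreePart K M A d) (hy : y ∈ degreePart K M A e)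
    (Ω : Cochains K (A × M) (A × M)) :
    gerstenhaber (gerstenhaber Ω (incl K A M x)) (incl K A M y) =
      sg K ((d - 1) * (e - 1)) •
        gerstenhaber (gerstenhaber Ω (incl K A M y)) (incl K A M x) :=
  gerstenhaber_right_comm (incl_mem hx) (incl_mem hy) (gerstenhaber_incl_incl x y) Ω

/-- Meant for a `w` that is itself a bracket. Since `L` is abelian, `w` can be moved to the last
place, which gives composites the shape produced by the Leibniz expansion of `[η, η]` and `[Θ, η]`.
-/
theorem incl_ternaryBracket_left (H : A →ₗ[K] A →ₗ[K] M) {k d e : ℤ} {w x y : Cochains K M A}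
    (hw : w ∈ degreePart K M A k) (hx : x ∈ degreePart K M A d) (hy : y ∈ degreePart K M A e) :
    incl K A M (ternaryBracket H w x y) = -sg K (d + (k - 1) * (d - 1) + (k - 1) * (e - 1)) •
      gerstenhaber (gerstenhaber (gerstenhaber (hom (ofBilin (bilinLift H))) (incl K A M x))
        (incl K A M y)) (incl K A M w) := by
  rw [incl_ternaryBracket H hw hx hy, gerstenhaber_incl_right_comm hw hx, map_smul,
    LinearMap.smul_apply, gerstenhaber_incl_right_comm hw hy, smul_smul, smul_smul, sg_add, sg_add,
    neg_mul, neg_mul]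

theorem incl_ternaryBracket_ternaryBracket (H : A →ₗ[K] A →ₗ[K] M) {a b c d e : ℤ}
    {u v w x y : Cochains K M A} (hu : u ∈ degreePart K M A a) (hv : v ∈ degreePart K M A b)
    (hw : w ∈ degreePart K M A c) (hx : x ∈ degreePart K M A d) (hy : y ∈ degreePart K M A e) :
    incl K A M (ternaryBracket H (ternaryBracket H u v w) x y) =
      sg K (b + d + (a + b + c) * (d + e)) •
      gerstenhaber (gerstenhaber (gerstenhaber (hom (ofBilin (bilinLift H))) (incl K A M x))
        (incl K A M y)) (gerstenhaber (gerstenhaber (gerstenhaber (hom (ofBilin (bilinLift H)))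
          (incl K A M u)) (incl K A M v)) (incl K A M w)) := by
  rw [incl_ternaryBracket_left H (ternaryBracket_mem H hu hv hw) hx hy,
    incl_ternaryBracket H hu hv hw, map_smul, smul_smul, neg_mul_neg, ← sg_add]
  congr 1
  exact sg_congr ⟨-(a + b + c) - (d + e) + 2, by ring⟩

variable [IsScalarTower K A A] [SMulCommClass K A A]

theorem incl_derivedBracket_left (B : Bimod K A M) {k d : ℤ} {w x : Cochains K M A}
    (hw : w ∈ degreePart K M A k) (hx : x ∈ degreePart K M A d) :
    incl K A M (derivedBracket B w x) = sg K (k + (k - 1) * (d - 1)) •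
      gerstenhaber (gerstenhaber (hom (ofBilin (semidirect B))) (incl K A M x))
        (incl K A M w) := by
  rw [incl_derivedBracket B hw hx, gerstenhaber_incl_right_comm hw hx, smul_smul, sg_add]

theorem incl_derivedBracket_derivedBracket (B : Bimod K A M) {a b d : ℤ}
    {u v x : Cochains K M A} (hu : u ∈ degreePart K M A a) (hv : v ∈ degreePart K M A b)
    (hx : x ∈ degreePart K M A d) :
    incl K A M (derivedBracket B (derivedBracket B u v) x) =
      sg K (1 + a + d + (a + b) * d) •
      gerstenhaber (gerstenhaber (hom (ofBilin (semidirect B))) (incl K A M x))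
        (gerstenhaber (gerstenhaber (hom (ofBilin (semidirect B))) (incl K A M u))
          (incl K A M v)) := by
  rw [incl_derivedBracket_left B (derivedBracket_mem B hu hv) hx,
    incl_derivedBracket B hu hv, map_smul, smul_smul, ← sg_add]
  congr 1
  exact sg_congr ⟨-d, by ring⟩

theorem incl_derivedBracket_ternaryBracket (B : Bimod K A M) (H : A →ₗ[K] A →ₗ[K] M) {a b c d : ℤ}
    {u v w x : Cochains K M A} (hu : u ∈ degreePart K M A a) (hv : v ∈ degreePart K M A b)
    (hw : w ∈ degreePart K M A c) (hx : x ∈ degreePart K M A d) :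
    incl K A M (derivedBracket B (ternaryBracket H u v w) x) =
      sg K (b + (a + b + c) * d) •
      gerstenhaber (gerstenhaber (hom (ofBilin (semidirect B))) (incl K A M x))
        (gerstenhaber (gerstenhaber (gerstenhaber (hom (ofBilin (bilinLift H)))
          (incl K A M u)) (incl K A M v)) (incl K A M w)) := by
  rw [incl_derivedBracket_left B (ternaryBracket_mem H hu hv hw) hx,
    incl_ternaryBracket H hu hv hw, map_smul, smul_smul, mul_neg, ← neg_one_mul, ← sg_one (K := K),
    ← sg_add, ← sg_add]
  congr 1
  exact sg_congr ⟨1 - d, by ring⟩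

theorem incl_ternaryBracket_derivedBracket (B : Bimod K A M) (H : A →ₗ[K] A →ₗ[K] M) {a b d e : ℤ}
    {u v x y : Cochains K M A} (hu : u ∈ degreePart K M A a) (hv : v ∈ degreePart K M A b)
    (hx : x ∈ degreePart K M A d) (hy : y ∈ degreePart K M A e) :
    incl K A M (ternaryBracket H (derivedBracket B u v) x y) =
      sg K (1 + a + e + (a + b) * (d + e)) •
      gerstenhaber (gerstenhaber (gerstenhaber (hom (ofBilin (bilinLift H))) (incl K A M x))
        (incl K A M y)) (gerstenhaber (gerstenhaber (hom (ofBilin (semidirect B)))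
          (incl K A M u)) (incl K A M v)) := by
  rw [incl_ternaryBracket_left H (derivedBracket_mem B hu hv) hx hy,
    incl_derivedBracket B hu hv, map_smul, smul_smul, neg_mul, ← neg_one_mul, ← sg_one (K := K),
    ← sg_add, ← sg_add]
  congr 1
  exact sg_congr ⟨1 - a - b - e, by ring⟩

end Composites

/-! ### The higher Jacobi identities for three, four and five entries -/

section Jacobi

variable {K A M : Type*} [Field K] [NonUnitalRing A] [Module K A]
  [AddCommGroup M] [Module K M]

/-- Right brackets with the `x i`, packaged as opaque operators known only through the derivation
rule and their commutation with `signOp`; this makes the Leibniz expansion a terminating rewriting.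
-/
theorem exists_right_bracket {ι : Type*} {d : ι → ℤ} {x : ι → Cochains K M A}
    (hx : ∀ a, x a ∈ degreePart K M A (d a)) :
    ∃ D : ι → Cochains K (A × M) (A × M) →ₗ[K] Cochains K (A × M) (A × M),
      (∀ i y, D i y = gerstenhaber y (incl K A M (x i))) ∧
      (∀ i y z, D i (gerstenhaber y z) =
        gerstenhaber y (D i z) + gerstenhaber (D i y) (signOp (d i - 1) z)) ∧
      (∀ i j y, signOp (d i - 1) (D j y) =
        sg K ((d i - 1) * (d j - 1)) • D j (signOp (d i - 1) y)) :=
  ⟨fun i => gerstenhaber.flip (incl K A M (x i)), fun _ _ => rfl,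
    fun i y z => gerstenhaber_leibniz (incl_mem (hx i)) y z,
    fun _ j y => signOp_gerstenhaber _ (incl_mem (hx j)) y⟩

theorem signOp_ofBilin {V : Type*} [AddCommGroup V] [Module K V] (e : ℤ) (Θ : V →ₗ[K] V →ₗ[K] V) :
    signOp e (hom (ofBilin Θ)) = sg K e • hom (ofBilin Θ) := by
  rw [signOp_of_mem e (hom_mem _)]
  congr 2
  push_cast
  ring

/-- Up to sign the triple bracket is a ternary bracket, hence in the abelian subalgebra `L`. -/
theorem gerstenhaber_bilinLift_incl_eq_zero (H : A →ₗ[K] A →ₗ[K] M) {d : Fin 4 → ℤ}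
    {x : Fin 4 → Cochains K M A} (hx : ∀ a, x a ∈ degreePart K M A (d a)) :
    gerstenhaber (gerstenhaber (gerstenhaber (gerstenhaber (hom (ofBilin (bilinLift H)))
      (incl K A M (x 0))) (incl K A M (x 1))) (incl K A M (x 2))) (incl K A M (x 3)) = 0 := by
  have h := incl_ternaryBracket H (hx 0) (hx 1) (hx 2)
  have h' := gerstenhaber_incl_incl (ternaryBracket H (x 0) (x 1) (x 2)) (x 3)
  rw [h, map_smul, LinearMap.smul_apply] at h'
  rcases sg_eq_or (K := K) (d 1) with hs | hs <;> simpa [hs] using h'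

set_option maxHeartbeats 4000000 in
theorem ternaryBracket_jacobi [CharZero K] (H : A →ₗ[K] A →ₗ[K] M) (d : Fin 5 → ℤ)
    (x : Fin 5 → Cochains K M A) (hx : ∀ a, x a ∈ degreePart K M A (d a))
    [DecidablePred (IsUnshuffle (n := 5) 3)] :
    ∑ σ : Equiv.Perm (Fin 5) with IsUnshuffle 3 σ, (Equiv.Perm.sign σ * koszulSign d σ) •
      ternaryBracket H (ternaryBracket H (x (σ 0)) (x (σ 1)) (x (σ 2))) (x (σ 3)) (x (σ 4)) =
      0 := by
  rw [sum_unshuffle_five_three (K := K) d fun i j k l m =>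
    ternaryBracket H (ternaryBracket H (x i) (x j) (x k)) (x l) (x m)]
  apply incl_injective
  simp only [map_add, map_smul, map_zero,
    fun i j k l m => incl_ternaryBracket_ternaryBracket H (hx i) (hx j) (hx k) (hx l) (hx m),
    smul_smul]
  have hk := fun i j k l => gerstenhaber_bilinLift_incl_eq_zero H
    (d := ![d i, d j, d k, d l]) (x := ![x i, x j, x k, x l])
    (by intro a; fin_cases a <;> exact hx _)
  -- Used to bring each surviving product to the order 2|3 in which the composites are written.
  have hs := fun i j k l m => gerstenhaber_skew
    (gerstenhaber_mem (gerstenhaber_mem (gerstenhaber_mem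
      (hom_mem (ofBilin (bilinLift H))) (incl_mem (hx i))) (incl_mem (hx j))) (incl_mem (hx k)))
    (gerstenhaber_mem (gerstenhaber_mem
      (hom_mem (ofBilin (bilinLift H))) (incl_mem (hx l))) (incl_mem (hx m)))
  have h := gerstenhaber_bilinLift_self H
  have hsg := signOp_ofBilin (K := K) (Θ := bilinLift H)
  obtain ⟨D, hD, hL, hS⟩ := exists_right_bracket hx
  simp only [Matrix.cons_val, ← hD] at hk hs ⊢
  generalize hom (ofBilin (bilinLift H)) = Ω at *
  -- Of the 32 distributions of five operators over the two factors of `[η, η]`, only 3|2 and 2|3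
  -- survive. Applying the operators in the order of their indices keeps the indices increasing
  -- within each factor, as for unshuffles.
  replace h := congrArg (fun y => D 4 (D 3 (D 2 (D 1 (D 0 y))))) h
  simp only [hL, hS, hsg, hk, hs, map_add, map_smul, map_zero, LinearMap.zero_apply,
    smul_zero, add_zero, zero_add, smul_smul] at h
  simp only [sg_add, sg_sub, sg_mul_two, sg_two_mul, sg_one, sg_two, sg_zero, mul_add, add_mul,
    mul_sub, sub_mul, mul_one, one_mul, Nat.cast_ofNat] at h ⊢
  rcases sg_parity K (d 0) with ⟨a0, b0, c0⟩ | ⟨a0, b0, c0⟩ <;>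
  rcases sg_parity K (d 1) with ⟨a1, b1, c1⟩ | ⟨a1, b1, c1⟩ <;>
  rcases sg_parity K (d 2) with ⟨a2, b2, c2⟩ | ⟨a2, b2, c2⟩ <;>
  rcases sg_parity K (d 3) with ⟨a3, b3, c3⟩ | ⟨a3, b3, c3⟩ <;>
  rcases sg_parity K (d 4) with ⟨a4, b4, c4⟩ | ⟨a4, b4, c4⟩ <;>
  simp only [a0, b0, c0, a1, b1, c1, a2, b2, c2, a3, b3, c3, a4, mul_one, mul_neg, neg_neg] at h ⊢ <;>
  first
    -- Each of the ten unshuffles occurs twice, once for each factor `η`, whence the `1 / 2`; its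
    -- sign depends on the parities.
    | linear_combination (norm := module) (1 / 2 : K) • h
    | linear_combination (norm := module) (-1 / 2 : K) • h

variable [IsScalarTower K A A] [SMulCommClass K A A]

theorem gerstenhaber_semidirect_incl_eq_zero (B : Bimod K A M) {d : Fin 3 → ℤ}
    {x : Fin 3 → Cochains K M A} (hx : ∀ a, x a ∈ degreePart K M A (d a)) :
    gerstenhaber (gerstenhaber (gerstenhaber (hom (ofBilin (semidirect B)))
      (incl K A M (x 0))) (incl K A M (x 1))) (incl K A M (x 2)) = 0 := by
  have h := incl_derivedBracket B (hx 0) (hx 1)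
  have h' := gerstenhaber_incl_incl (derivedBracket B (x 0) (x 1)) (x 2)
  rw [h, map_smul, LinearMap.smul_apply] at h'
  rcases sg_eq_or (K := K) (d 0) with hs | hs <;> simpa [hs] using h'

set_option maxHeartbeats 4000000 in
theorem derivedBracket_jacobi [CharZero K] (B : Bimod K A M) (d : Fin 3 → ℤ)
    (x : Fin 3 → Cochains K M A) (hx : ∀ a, x a ∈ degreePart K M A (d a))
    [DecidablePred (IsUnshuffle (n := 3) 2)] :
    ∑ σ : Equiv.Perm (Fin 3) with IsUnshuffle 2 σ, (Equiv.Perm.sign σ * koszulSign d σ) •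
      derivedBracket B (derivedBracket B (x (σ 0)) (x (σ 1))) (x (σ 2)) = 0 := by
  rw [sum_unshuffle_three_two (K := K) d fun i j k =>
    derivedBracket B (derivedBracket B (x i) (x j)) (x k)]
  apply incl_injective
  simp only [map_add, map_smul, map_zero,
    fun i j k => incl_derivedBracket_derivedBracket B (hx i) (hx j) (hx k), smul_smul]
  have hk := fun i j k => gerstenhaber_semidirect_incl_eq_zero B
    (d := ![d i, d j, d k]) (x := ![x i, x j, x k]) (by intro a; fin_cases a <;> exact hx _)
  have hs := fun i j k => gerstenhaber_skew
    (gerstenhaber_mem (gerstenhaber_mem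
      (hom_mem (ofBilin (semidirect B))) (incl_mem (hx i))) (incl_mem (hx j)))
    (gerstenhaber_mem (hom_mem (ofBilin (semidirect B))) (incl_mem (hx k)))
  have h := gerstenhaber_semidirect_self B
  have hsg := signOp_ofBilin (K := K) (Θ := semidirect B)
  obtain ⟨D, hD, hL, hS⟩ := exists_right_bracket hx
  simp only [Matrix.cons_val, ← hD] at hk hs ⊢
  generalize hom (ofBilin (semidirect B)) = Ω at *
  replace h := congrArg (fun y => D 2 (D 1 (D 0 y))) h
  simp only [hL, hS, hsg, hk, hs, map_add, map_smul, map_zero, LinearMap.zero_apply,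
    smul_zero, add_zero, zero_add, smul_smul] at h
  simp only [sg_add, sg_sub, sg_mul_two, sg_two_mul, sg_one, sg_two, sg_zero, mul_add, add_mul,
    mul_sub, sub_mul, mul_one, one_mul, Nat.cast_ofNat] at h ⊢
  rcases sg_parity K (d 0) with ⟨a0, b0, c0⟩ | ⟨a0, b0, c0⟩ <;>
  rcases sg_parity K (d 1) with ⟨a1, b1, c1⟩ | ⟨a1, b1, c1⟩ <;>
  rcases sg_parity K (d 2) with ⟨a2, b2, c2⟩ | ⟨a2, b2, c2⟩ <;>
  simp only [a0, b0, c0, a1, b1, c1, a2, mul_one, mul_neg, neg_neg] at h ⊢ <;>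
  first
    | linear_combination (norm := module) (1 / 2 : K) • h
    | linear_combination (norm := module) (-1 / 2 : K) • h

set_option maxHeartbeats 4000000 in
theorem derivedBracket_ternaryBracket_jacobi {B : Bimod K A M} {H : A →ₗ[K] A →ₗ[K] M}
    (hH : IsHochschildTwoCocycle B H) (d : Fin 4 → ℤ)
    (x : Fin 4 → Cochains K M A) (hx : ∀ a, x a ∈ degreePart K M A (d a))
    [DecidablePred (IsUnshuffle (n := 4) 2)] [DecidablePred (IsUnshuffle (n := 4) 3)] :
    ∑ σ : Equiv.Perm (Fin 4) with IsUnshuffle 2 σ, (Equiv.Perm.sign σ * koszulSign d σ) •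
      ternaryBracket H (derivedBracket B (x (σ 0)) (x (σ 1))) (x (σ 2)) (x (σ 3)) =
    ∑ σ : Equiv.Perm (Fin 4) with IsUnshuffle 3 σ, (Equiv.Perm.sign σ * koszulSign d σ) •
      derivedBracket B (ternaryBracket H (x (σ 0)) (x (σ 1)) (x (σ 2))) (x (σ 3)) := by
  rw [sum_unshuffle_four_two (K := K) d fun i j k l =>
      ternaryBracket H (derivedBracket B (x i) (x j)) (x k) (x l),
    sum_unshuffle_four_three (K := K) d fun i j k l =>
      derivedBracket B (ternaryBracket H (x i) (x j) (x k)) (x l)]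
  apply incl_injective
  simp only [map_add, map_smul,
    fun i j k l => incl_ternaryBracket_derivedBracket B H (hx i) (hx j) (hx k) (hx l),
    fun i j k l => incl_derivedBracket_ternaryBracket B H (hx i) (hx j) (hx k) (hx l), smul_smul]
  have hk := fun i j k => gerstenhaber_semidirect_incl_eq_zero B
    (d := ![d i, d j, d k]) (x := ![x i, x j, x k]) (by intro a; fin_cases a <;> exact hx _)
  have hk' := fun i j k l => gerstenhaber_bilinLift_incl_eq_zero H
    (d := ![d i, d j, d k, d l]) (x := ![x i, x j, x k, x l])
    (by intro a; fin_cases a <;> exact hx _)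
  have hs := fun i j k l => gerstenhaber_skew
    (gerstenhaber_mem (gerstenhaber_mem
      (hom_mem (ofBilin (semidirect B))) (incl_mem (hx i))) (incl_mem (hx j)))
    (gerstenhaber_mem (gerstenhaber_mem
      (hom_mem (ofBilin (bilinLift H))) (incl_mem (hx k))) (incl_mem (hx l)))
  -- The only place where the cocycle condition enters. The factors `Θ` and `η` differ, so each term
  -- occurs once and nothing is divided by 2.
  have h := gerstenhaber_semidirect_bilinLift hH
  have hsg := signOp_ofBilin (K := K) (Θ := bilinLift H)
  obtain ⟨D, hD, hL, hS⟩ := exists_right_bracket hx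
  simp only [Matrix.cons_val, ← hD] at hk hk' hs ⊢
  generalize hom (ofBilin (semidirect B)) = Ψ at *
  generalize hom (ofBilin (bilinLift H)) = Ω at *
  replace h := congrArg (fun y => D 3 (D 2 (D 1 (D 0 y)))) h
  simp only [hL, hS, hsg, hk, hk', hs, map_add, map_smul, map_zero, LinearMap.zero_apply,
    smul_zero, add_zero, zero_add, smul_smul] at h
  simp only [sg_add, sg_sub, sg_mul_two, sg_two_mul, sg_one, sg_two, sg_zero, mul_add, add_mul,
    mul_sub, sub_mul, mul_one, one_mul, Nat.cast_ofNat] at h ⊢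
  rcases sg_parity K (d 0) with ⟨a0, b0, c0⟩ | ⟨a0, b0, c0⟩ <;>
  rcases sg_parity K (d 1) with ⟨a1, b1, c1⟩ | ⟨a1, b1, c1⟩ <;>
  rcases sg_parity K (d 2) with ⟨a2, b2, c2⟩ | ⟨a2, b2, c2⟩ <;>
  rcases sg_parity K (d 3) with ⟨a3, b3, c3⟩ | ⟨a3, b3, c3⟩ <;>
  simp only [a0, b0, c0, a1, b1, c1, a2, b2, c2, a3, mul_one, mul_neg, neg_neg] at h ⊢ <;>
  first
    | linear_combination (norm := module) h
    | linear_combination (norm := module) (-1 : K) • h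

end Jacobi

/-! ### The grading by integers -/

section Grading

variable (K V W : Type*) [Field K] [AddCommGroup V] [Module K V] [AddCommGroup W] [Module K W]

/-- The decomposition of `⨁ₙ Hom(V^{⊗ n}, W)` into its parts of integral degree. -/
def degreeDecomposition : Cochains K V W →ₗ[K] ⨁ d : ℤ, degreePart K V W d :=
  DirectSum.toModule K ℕ _ fun n =>
    DirectSum.lof K ℤ (fun d => degreePart K V W d) n ∘ₗ
      LinearMap.codRestrict (degreePart K V W n) (DirectSum.lof K ℕ (Cochain K V W) n) hom_mem

theorem degreeDecomposition_hom {n : ℕ} (f : Cochain K V W n) :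
    degreeDecomposition K V W (hom f) =
      DirectSum.of (fun d => degreePart K V W d) n ⟨hom f, hom_mem f⟩ := by
  rw [degreeDecomposition, DirectSum.toModule_lof]
  rfl

theorem degreePart_isInternal : DirectSum.IsInternal (degreePart K V W) := by
  refine @DirectSum.Decomposition.isInternal _ _ _ _ _ _ _ (degreePart K V W)
    ⟨degreeDecomposition K V W, fun x => ?_, fun y => ?_⟩
  · induction x using cochains_induction with
    | zero => simp
    | add x y hx hy => rw [map_add, map_add, hx, hy]
    | hom n f => rw [degreeDecomposition_hom, DirectSum.coeAddMonoidHom_of]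
  · induction y using DirectSum.induction_on with
    | zero => simp
    | add x y hx hy => rw [map_add, map_add, hx, hy]
    | of d x =>
      obtain ⟨x, hx⟩ := x
      rw [DirectSum.coeAddMonoidHom_of]
      rcases eq_zero_or_hom_of_mem hx with rfl | ⟨n, f, rfl, rfl⟩
      · rw [map_zero]
        exact (map_zero (DirectSum.of (fun d => degreePart K V W d) d)).symm
      · exact degreeDecomposition_hom K V W f

end Grading

/-! ### Skew-symmetry and the L-infinity structure -/

section Structure

variable {K A M : Type*} [Field K] [NonUnitalRing A] [Module K A]
  [AddCommGroup M] [Module K M]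

theorem ternaryBracket_swap_left (H : A →ₗ[K] A →ₗ[K] M) {a b c : ℤ} {x y z : Cochains K M A}
    (hx : x ∈ degreePart K M A a) (hy : y ∈ degreePart K M A b) (hz : z ∈ degreePart K M A c) :
    ternaryBracket H y x z = sg K (1 + a * b) • ternaryBracket H x y z := by
  apply incl_injective
  rw [map_smul, incl_ternaryBracket H hx hy hz, incl_ternaryBracket H hy hx hz,
    gerstenhaber_incl_right_comm hy hx, map_smul, LinearMap.smul_apply, smul_smul, smul_smul,
    neg_mul, mul_neg, ← sg_add, ← sg_add]
  congr 2
  exact sg_congr ⟨-b, by ring⟩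

theorem ternaryBracket_swap_right (H : A →ₗ[K] A →ₗ[K] M) {a b c : ℤ} {x y z : Cochains K M A}
    (hx : x ∈ degreePart K M A a) (hy : y ∈ degreePart K M A b) (hz : z ∈ degreePart K M A c) :
    ternaryBracket H x z y = sg K (1 + b * c) • ternaryBracket H x y z := by
  apply incl_injective
  rw [map_smul, incl_ternaryBracket H hx hy hz, incl_ternaryBracket H hx hz hy,
    gerstenhaber_incl_right_comm hz hy, smul_smul, smul_smul,
    neg_mul, mul_neg, ← sg_add, ← sg_add]
  congr 2
  exact sg_congr ⟨-b, by ring⟩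

theorem mem_perm_two (σ : Equiv.Perm (Fin 2)) :
    σ = permOf ![0, 1] ![0, 1] (by decide) (by decide) ∨
    σ = permOf ![1, 0] ![1, 0] (by decide) (by decide) := by
  revert σ
  decide +kernel

theorem mem_perm_three (σ : Equiv.Perm (Fin 3)) :
    σ = permOf ![0, 1, 2] ![0, 1, 2] (by decide) (by decide) ∨
    σ = permOf ![0, 2, 1] ![0, 2, 1] (by decide) (by decide) ∨
    σ = permOf ![1, 0, 2] ![1, 0, 2] (by decide) (by decide) ∨
    σ = permOf ![1, 2, 0] ![2, 0, 1] (by decide) (by decide) ∨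
    σ = permOf ![2, 0, 1] ![1, 2, 0] (by decide) (by decide) ∨
    σ = permOf ![2, 1, 0] ![2, 1, 0] (by decide) (by decide) := by
  revert σ
  decide +kernel

/-- Each permutation is a product of adjacent transpositions, for which graded skew-symmetry comes
from the graded commutation of right brackets. -/
theorem ternaryBracket_perm (H : A →ₗ[K] A →ₗ[K] M) {d : Fin 3 → ℤ} {x : Fin 3 → Cochains K M A}
    (hx : ∀ a, x a ∈ degreePart K M A (d a)) (σ : Equiv.Perm (Fin 3)) :
    ternaryBracket H (x (σ 0)) (x (σ 1)) (x (σ 2)) =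
      (Equiv.Perm.sign σ * koszulSign d σ) • ternaryBracket H (x 0) (x 1) (x 2) := by
  rw [units_smul_eq (K := K), sign_mul_koszulSign]
  have hl := fun i j k => ternaryBracket_swap_left H (hx i) (hx j) (hx k)
  have hr := fun i j k => ternaryBracket_swap_right H (hx i) (hx j) (hx k)
  rcases mem_perm_three σ with rfl | rfl | rfl | rfl | rfl | rfl <;>
  simp [Fintype.sum_prod_type, Fin.sum_univ_succ, sg_zero, -Matrix.cons_val_fin_one]
  · rw [hr 0 1 2, mul_comm (d 1)]
  · rw [hl 0 1 2, mul_comm (d 0)]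
  · rw [hr 1 0 2, hl 0 1 2, smul_smul, ← sg_add]
    congr 2
    ring
  · rw [hl 0 2 1, hr 0 1 2, smul_smul, ← sg_add]
    congr 2
    ring
  · rw [hl 1 2 0, hr 1 0 2, hl 0 1 2, smul_smul, smul_smul, ← sg_add, ← sg_add]
    congr 2
    ring

variable [IsScalarTower K A A] [SMulCommClass K A A]

theorem derivedBracket_swap (B : Bimod K A M) {a b : ℤ} {x y : Cochains K M A}
    (hx : x ∈ degreePart K M A a) (hy : y ∈ degreePart K M A b) :
    derivedBracket B y x = sg K (1 + a * b) • derivedBracket B x y := by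
  apply incl_injective
  rw [map_smul, incl_derivedBracket B hx hy, incl_derivedBracket B hy hx,
    gerstenhaber_incl_right_comm hy hx, smul_smul, smul_smul, ← sg_add, ← sg_add]
  congr 1
  exact sg_congr ⟨-a, by ring⟩

theorem derivedBracket_perm (B : Bimod K A M) {d : Fin 2 → ℤ} {x : Fin 2 → Cochains K M A}
    (hx : ∀ a, x a ∈ degreePart K M A (d a)) (σ : Equiv.Perm (Fin 2)) :
    derivedBracket B (x (σ 0)) (x (σ 1)) =
      (Equiv.Perm.sign σ * koszulSign d σ) • derivedBracket B (x 0) (x 1) := by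
  rw [units_smul_eq (K := K), sign_mul_koszulSign]
  rcases mem_perm_two σ with rfl | rfl <;>
  simp [Fintype.sum_prod_type, Fin.sum_univ_succ, sg_zero]
  rw [derivedBracket_swap B (hx 0) (hx 1), mul_comm (d 0)]

theorem brackets_eq_zero (B : Bimod K A M) (H : A →ₗ[K] A →ₗ[K] M) {k : ℕ} (h2 : k ≠ 2)
    (h3 : k ≠ 3) : brackets B H k = 0 := by
  unfold brackets
  split
  · exact absurd rfl h2
  · exact absurd rfl h3
  · rfl

theorem brackets_cons_eq_zero (B : Bimod K A M) (H : A →ₗ[K] A →ₗ[K] M) {j k : ℕ}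
    (h : ¬(j = 2 ∨ j = 3) ∨ ¬(k = 1 ∨ k = 2)) (x : Fin j → Cochains K M A)
    (y : Fin k → Cochains K M A) :
    brackets B H (k + 1) (Fin.cons (brackets B H j x) y) = 0 := by
  rcases h with h | h
  · rw [brackets_eq_zero B H (k := j) (by tauto) (by tauto)]
    exact MultilinearMap.map_coord_zero _ 0 rfl
  · rw [brackets_eq_zero B H (by omega) (by omega)]
    rfl

/-- A composite is nonzero only if both brackets have 2 or 3 entries, which leaves `n = 3, 4, 5`. -/
theorem higherJacobi_brackets [CharZero K] {B : Bimod K A M} {H : A →ₗ[K] A →ₗ[K] M}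
    (hH : IsHochschildTwoCocycle B H) {n : ℕ} (d : Fin n → ℤ) (x : Fin n → Cochains K M A)
    (hx : ∀ a, x a ∈ degreePart K M A (d a)) : higherJacobi (brackets B H) n d x = 0 := by
  classical
  have hz : ∀ i : Fin n, (¬(i.val + 1 = 2 ∨ i.val + 1 = 3) ∨
      ¬(n - (i.val + 1) = 1 ∨ n - (i.val + 1) = 2)) →
      ∑ σ : Equiv.Perm (Fin n) with IsUnshuffle (i.val + 1) σ,
    (Equiv.Perm.sign σ * koszulSign d σ * (-1 : ℤˣ) ^ ((i.val + 1) * (n - (i.val + 1)))) •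
      brackets B H (n - (i.val + 1) + 1)
        (Fin.cons
          (brackets B H (i.val + 1) (fun a => x (σ ⟨a.val, by omega⟩)))
          (fun b => x (σ ⟨i.val + 1 + b.val, by omega⟩))) = 0 := fun i hi =>
    Finset.sum_eq_zero fun σ _ => by rw [brackets_cons_eq_zero B H hi, smul_zero]
  by_cases h3 : n = 3
  · subst h3
    rw [higherJacobi, Finset.sum_eq_single 1]
    · refine Eq.trans (Finset.sum_congr rfl fun σ _ => ?_) (derivedBracket_jacobi B d x hx)
      change (Equiv.Perm.sign σ * koszulSign d σ * (-1 : ℤˣ) ^ (2 * 1)) • _ = _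
      rw [show (-1 : ℤˣ) ^ (2 * 1) = 1 by decide, mul_one]
      rfl
    · intro i _ hi
      convert hz i _
      have := i.isLt
      rw [Fin.ne_iff_vne] at hi
      simp at hi
      omega
    · simp
  by_cases h5 : n = 5
  · subst h5
    rw [higherJacobi, Finset.sum_eq_single 2]
    · refine Eq.trans (Finset.sum_congr rfl fun σ _ => ?_) (ternaryBracket_jacobi H d x hx)
      change (Equiv.Perm.sign σ * koszulSign d σ * (-1 : ℤˣ) ^ (3 * 2)) • _ = _
      rw [show (-1 : ℤˣ) ^ (3 * 2) = 1 by decide, mul_one]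
      rfl
    · intro i _ hi
      convert hz i _
      have := i.isLt
      rw [Fin.ne_iff_vne] at hi
      simp at hi
      omega
    · simp
  by_cases h4 : n = 4
  · subst h4
    have h := derivedBracket_ternaryBracket_jacobi hH d x hx
    rw [← sub_eq_zero, sub_eq_add_neg, ← Finset.sum_neg_distrib] at h
    rw [higherJacobi, Fin.sum_univ_four]
    refine Eq.trans ?_ h
    have h0 := hz 0 (by decide)
    have h3 := hz 3 (by decide)
    -- The middle terms, with inner bracket of 2 or 3 entries, form the mixed identity; the outer
    -- two vanish.
    rw [show ∀ a b c e : Cochains K M A, a + b + c + e = (b + c) + (a + e) by intros; abel]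
    conv_rhs => rw [← add_zero (Finset.sum _ _ + _)]
    congr 1
    · congr 1
      · refine Finset.sum_congr (by congr) fun σ _ => ?_
        change (Equiv.Perm.sign σ * koszulSign d σ * (-1 : ℤˣ) ^ (2 * 2)) • _ = _
        rw [show (-1 : ℤˣ) ^ (2 * 2) = 1 by decide, mul_one]
        rfl
      · refine Finset.sum_congr (by congr) fun σ _ => ?_
        change (Equiv.Perm.sign σ * koszulSign d σ * (-1 : ℤˣ) ^ (3 * 1)) • _ = _
        -- The sign `(-1)^{i(j-1)}` is `-1` here and `+1` for `i = 2`, `j = 3`, so the sum is the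
        -- difference of the two sides of the mixed identity.
        rw [show (-1 : ℤˣ) ^ (3 * 1) = -1 by decide, mul_neg_one, Units.neg_smul]
        rfl
    · convert add_zero (0 : Cochains K M A) using 2
  · exact Finset.sum_eq_zero fun i _ => by
      convert hz i _
      have := i.isLt
      omega

theorem brackets_isLInfinityAlgebra [CharZero K] {B : Bimod K A M} {H : A →ₗ[K] A →ₗ[K] M}
    (hH : IsHochschildTwoCocycle B H) :
    IsLInfinityAlgebra (degreePart K M A) (brackets B H) where
  graded := degreePart_isInternal K M A
  degree k _ d x hx := by
    by_cases h2 : k = 2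
    · subst h2
      have h := derivedBracket_mem B (hx 0) (hx 1)
      rw [Fin.sum_univ_two, Nat.cast_ofNat, add_sub_cancel_right]
      exact h
    by_cases h3 : k = 3
    · subst h3
      have h := ternaryBracket_mem H (hx 0) (hx 1) (hx 2)
      rw [Fin.sum_univ_three, show d 0 + d 1 + d 2 + 2 - ((3 : ℕ) : ℤ) = d 0 + d 1 + d 2 - 1 by
        push_cast; ring]
      exact h
    · rw [brackets_eq_zero B H h2 h3]
      exact Submodule.zero_mem _
  skew k _ d x hx σ := by
    by_cases h2 : k = 2
    · subst h2
      exact derivedBracket_perm B hx σ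
    by_cases h3 : k = 3
    · subst h3
      exact ternaryBracket_perm H hx σ
    · rw [brackets_eq_zero B H h2 h3, zero_apply, zero_apply,
        smul_zero]
  jacobi _ _ d x hx := higherJacobi_brackets hH d x hx

end Structure

/-! ### Maurer–Cartan elements and twisted Rota–Baxter operators -/

section MaurerCartan

variable {K A M : Type*} [Field K] [NonUnitalRing A] [Module K A]
  [AddCommGroup M] [Module K M]

theorem evalSeq_ternaryBracket_ofLinear (H : A →ₗ[K] A →ₗ[K] M) (T : M →ₗ[K] A) (u : ℕ → M) :
    evalSeq (ternaryBracket H (ofLinear T) (ofLinear T) (ofLinear T)) u =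
      -(6 : K) • T (H (T (u 0)) (T (u 1))) := by
  rw [ofLinear, ternaryBracket, extend₃_hom]
  set P : Cochain K M A 1 := MultilinearMap.ofSubsingleton K M A (0 : Fin 1) T with hP
  have h : evalSeq (ternaryTerm H P P P) u = -T (H (T (u 0)) (T (u 1))) := by
    rw [ternaryTerm, map_neg, map_smul, Pi.neg_apply, Pi.smul_apply, evalSeq_circ]
    simp only [cup_apply]
    simp [hP, insertSeq]
  -- For `p = q = r = 1` all six terms coincide and enter with sign `+1`.
  change evalSeq (ternaryTerm H P P P - (-1 : K) ^ (1 * 1) • ternaryTerm H P P P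
      - (-1 : K) ^ (1 * 1) • ternaryTerm H P P P + (-1 : K) ^ (1 * (1 + 1)) • ternaryTerm H P P P
      - (-1 : K) ^ (1 * 1 + 1 * 1 + 1 * 1) • ternaryTerm H P P P
      + (-1 : K) ^ ((1 + 1) * 1) • ternaryTerm H P P P) u = _
  simp only [map_add, map_sub, map_smul, Pi.add_apply, Pi.sub_apply, Pi.smul_apply, h]
  norm_num
  module

variable [IsScalarTower K A A] [SMulCommClass K A A]

theorem evalSeq_derivedBracket_ofLinear (B : Bimod K A M) (T : M →ₗ[K] A) (u : ℕ → M) :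
    evalSeq (derivedBracket B (ofLinear T) (ofLinear T)) u =
      (2 : K) • (T (B.right (u 0) (T (u 1)) + B.left (T (u 0)) (u 1)) - T (u 0) * T (u 1)) := by
  -- The bracket is read off in the large algebra by evaluating on a sequence of elements `(0, u)`.
  have h := congrArg Prod.fst (evalSeq_incl (derivedBracket B (ofLinear T) (ofLinear T))
    fun a => (0, u a))
  change _ = evalSeq (derivedBracket B (ofLinear T) (ofLinear T)) u at h
  rw [← h, ofLinear, incl_derivedBracket_hom, incl_hom, gerstenhaber_gerstenhaber_lift]
  simp only [map_add, map_sub, map_smul, Pi.add_apply, Pi.sub_apply, Pi.smul_apply,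
    evalSeq_comp_circ, evalSeq_comp_hom_circ]
  simp [Finset.sum_range_succ, insertSeq, semidirect_apply]
  module

theorem isMaurerCartan_ofLinear_iff (B : Bimod K A M) (H : A →ₗ[K] A →ₗ[K] M) (T : M →ₗ[K] A) :
    IsMaurerCartan (degreePart K M A) (brackets B H) (ofLinear T) ↔
      (2 : K)⁻¹ • derivedBracket B (ofLinear T) (ofLinear T) -
        (6 : K)⁻¹ • ternaryBracket H (ofLinear T) (ofLinear T) (ofLinear T) = 0 := by
  have hsum : ∀ N, (∀ k, N < k → brackets B H k (fun _ => ofLinear T) = 0) →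
      ∑ k ∈ Finset.Icc 1 N, ((-1 : K) ^ ((k - 1) * (k - 2) / 2) * ((k.factorial : ℕ) : K)⁻¹) •
        brackets B H k (fun _ => ofLinear T) =
      (2 : K)⁻¹ • derivedBracket B (ofLinear T) (ofLinear T) -
        (6 : K)⁻¹ • ternaryBracket H (ofLinear T) (ofLinear T) (ofLinear T) := by
    -- `N` may be smaller than 3; the terms for 2 and 3 beyond `N` are then zero by `hN`, so the sum
    -- does not depend on `N`.
    intro N hN
    have h1 : ∑ k ∈ ({2, 3} : Finset ℕ),
        ((-1 : K) ^ ((k - 1) * (k - 2) / 2) * ((k.factorial : ℕ) : K)⁻¹) •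
          brackets B H k (fun _ => ofLinear T) =
      (2 : K)⁻¹ • derivedBracket B (ofLinear T) (ofLinear T) -
        (6 : K)⁻¹ • ternaryBracket H (ofLinear T) (ofLinear T) (ofLinear T) := by
      rw [Finset.sum_pair (by decide)]
      change ((-1 : K) ^ 0 * ((2 : ℕ) : K)⁻¹) • derivedBracket B (ofLinear T) (ofLinear T) +
        ((-1 : K) ^ 1 * ((6 : ℕ) : K)⁻¹) •
          ternaryBracket H (ofLinear T) (ofLinear T) (ofLinear T) = _
      push_cast
      module
    rw [← h1]
    refine Finset.sum_congr_of_eq_on_inter ?_ ?_ fun _ _ _ => rfl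
    · intro k _ hk
      simp only [Finset.mem_insert, Finset.mem_singleton, not_or] at hk
      rw [brackets_eq_zero B H hk.1 hk.2, zero_apply, smul_zero]
    · intro k hk hk'
      simp only [Finset.mem_insert, Finset.mem_singleton] at hk
      simp only [Finset.mem_Icc] at hk'
      rw [hN k (by omega), smul_zero]
  constructor
  · rintro ⟨-, N, hN, h⟩
    rw [← hsum N hN, h]
  · intro h
    have h3 : ∀ k, 3 < k → brackets B H k (fun _ => ofLinear T) = 0 := by
      intro k hk
      rw [brackets_eq_zero B H (by omega) (by omega)]
      rfl
    exact ⟨hom_mem _, 3, h3, by rw [hsum 3 h3, h]⟩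

theorem isTwistedRotaBaxter_iff_isMaurerCartan [CharZero K] (B : Bimod K A M)
    (H : A →ₗ[K] A →ₗ[K] M) (T : M →ₗ[K] A) :
    IsTwistedRotaBaxter B H T ↔
      IsMaurerCartan (degreePart K M A) (brackets B H) (ofLinear T) := by
  have heval : ∀ u : ℕ → M, evalSeq ((2 : K)⁻¹ • derivedBracket B (ofLinear T) (ofLinear T) -
        (6 : K)⁻¹ • ternaryBracket H (ofLinear T) (ofLinear T) (ofLinear T)) u =
      T (B.right (u 0) (T (u 1)) + B.left (T (u 0)) (u 1) + H (T (u 0)) (T (u 1))) -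
        T (u 0) * T (u 1) := by
    intro u
    rw [map_sub, map_smul, map_smul, Pi.sub_apply, Pi.smul_apply, Pi.smul_apply,
      evalSeq_derivedBracket_ofLinear, evalSeq_ternaryBracket_ofLinear, map_add T (_ + _) (H _ _)]
    module
  rw [isMaurerCartan_ofLinear_iff]
  constructor
  · intro h
    refine cochains_ext fun u => ?_
    rw [heval, h, sub_self, map_zero, Pi.zero_apply]
  · intro h u v
    -- Only the first two entries matter, so the sequence `u, v, v, …` represents the pair.
    have hu := heval fun a => if a = 0 then u else v
    rw [h, map_zero, Pi.zero_apply] at hu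
    exact (sub_eq_zero.mp hu.symm).symm

end MaurerCartan

end TwistedRB

end

theorem mainTheorem1 {K A M : Type*} [Field K] [CharZero K] [NonUnitalRing A] [Module K A]
    [IsScalarTower K A A] [SMulCommClass K A A] [AddCommGroup M] [Module K M]
    (B : TwistedRB.Bimod K A M) (H : A →ₗ[K] A →ₗ[K] M)
    (hH : TwistedRB.IsHochschildTwoCocycle B H) :
    (∀ (p q : ℕ) (P : TwistedRB.Cochain K M A p) (Q : TwistedRB.Cochain K M A q),
      TwistedRB.incl K A M
          (TwistedRB.derivedBracket B (TwistedRB.hom P) (TwistedRB.hom Q)) =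
        (-1 : K) ^ p •
          TwistedRB.gerstenhaber
            (TwistedRB.gerstenhaber
              (TwistedRB.hom (TwistedRB.ofBilin (TwistedRB.semidirect B)))
              (TwistedRB.incl K A M (TwistedRB.hom P)))
            (TwistedRB.incl K A M (TwistedRB.hom Q))) ∧
    TwistedRB.IsLInfinityAlgebra (TwistedRB.degreePart K M A) (TwistedRB.brackets B H) ∧
    ∀ T : M →ₗ[K] A,
      TwistedRB.IsTwistedRotaBaxter B H T ↔
        TwistedRB.IsMaurerCartan (TwistedRB.degreePart K M A) (TwistedRB.brackets B H)
          (TwistedRB.ofLinear T) :=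
  ⟨fun _ _ P Q => TwistedRB.incl_derivedBracket_hom B P Q,
    TwistedRB.brackets_isLInfinityAlgebra hH,
    fun T => TwistedRB.isTwistedRotaBaxter_iff_isMaurerCartan B H T⟩
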